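/- Let $G_0=\mathrm{PSL}_2(\mathbb{R})$ act on the hyperbolic plane $\mathbb{H}^2$ by orientation-preserving isometries; as a Lorentzian manifold, $G_0\simeq\mathrm{AdS}^3$, viewed as an open subset of $\mathbb{P}(\mathrm{M}_2(\mathbb{R}))$. For a geodesic line $\ell$ of $\mathbb{H}^2$, let $\mathsf{C}(\ell)\subset G_0$ be the left AdS crooked plane: the set consisting of the identity $e$, the elliptic elements whose fixed point lies on $\ell$, the parabolic elements fixing an endpoint of $\ell$, and the hyperbolic elements whose attracting fixed point is an endpoint of $\ell$. If $\ell$ is transversely oriented, let the stem quadrant $\mathsf{SQ}(\ell)\subset G_0$ be the set of hyperbolic elements whose axis is orthogonal to $\ell$ and which translate towards the positive side of $\ell$, and let $\partial\mathsf{SQ}(\ell)$ be the boundary of $\mathsf{SQ}(\ell)$ in the timelike plane of $\mathrm{AdS}^3$ that contains it (the intersection of $G_0$ with the projective span of $\mathsf{SQ}(\ell)$). Let $\ell,\ell'$ be two geodesic lines of $\mathbb{H}^2$ with disjoint closures in $\mathbb{H}^2\cup\partial_\infty\mathbb{H}^2$, transversely oriented away from each other (each line lies on the negative side of the other). Let $$\mathscr{C}=\Big\{h\in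 G_0 \;\Big|\; \inf_{(x,x')\in\ell\times\ell'} \big(d(x,h\cdot x')-d(x,x')\big)>0\Big\},$$ and let $\mathscr{C}_0$ be the set of $h\in\mathscr{C}$ such that $\ell$ and $h\cdot\ell'$, with the transverse orientation of $h\cdot\ell'$ induced by that of $\ell'$ via $h$, are still oriented away from each other. Then: 1. $\mathscr{C}=\{h\in G_0 \mid \mathsf{C}(\ell)\cap h\,\mathsf{C}(\ell')=\emptyset\}$; 2. $\mathscr{C}_0$ is a connected component of $\mathscr{C}$; 3. the product map $(g,g')\mapsto gg'$ restricts to homeomorphisms $$\mathsf{SQ}(\ell)^{-1}\times\partial\mathsf{SQ}(\ell')\;\overset{\sim}{\longrightarrow}\;\mathscr{C}_0 \qquad\text{and}\qquad \partial\mathsf{SQ}(\ell)^{-1}\times\mathsf{SQ}(\ell')\;\overset{\sim}{\longrightarrow}\;\mathscr{C}_0 .$$ -/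

import Mathlib

open scoped MatrixGroups UpperHalfPlane Pointwise LinearAlgebra.Projectivization

noncomputable section

/-- The central elements `± 1` of `SL(2, ℝ)` act trivially on the upper half-plane. -/
theorem center_le_ker_toPermHom :
    Subgroup.center SL(2, ℝ) ≤ (MulAction.toPermHom SL(2, ℝ) ℍ).ker := by
  intro A hA
  obtain ⟨r, hr, hrA⟩ := Matrix.SpecialLinearGroup.mem_center_iff.mp hA
  have hr0 : r ≠ 0 := by
    rintro rfl
    simp at hr
  rw [MonoidHom.mem_ker]
  ext z
  have h00 : A 0 0 = r := by
    rw [← hrA]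
    simp
  have h01 : A 0 1 = 0 := by
    rw [← hrA]
    simp
  have h10 : A 1 0 = 0 := by
    rw [← hrA]
    simp
  have h11 : A 1 1 = r := by
    rw [← hrA]
    simp
  have hrc : (r : ℂ) ≠ 0 := by exact_mod_cast hr0
  simp only [MulAction.toPermHom_apply, MulAction.toPerm_apply, Equiv.Perm.coe_one, id_eq]
  rw [UpperHalfPlane.coe_specialLinearGroup_apply, h00, h01, h10, h11]
  simp [hrc]

/-- `PSL(2, ℝ)`, the group of orientation-preserving isometries of the hyperbolic plane, acts on
the upper half-plane `ℍ` by Möbius transformations. (Its action on the ideal boundary, the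
projective line `ℙ ℝ (Fin 2 → ℝ)`, and its quotient topology are those of Mathlib.) -/
instance pslMulActionUpperHalfPlane : MulAction PSL(2, ℝ) ℍ :=
  MulAction.compHom ℍ
    (QuotientGroup.lift (Subgroup.center SL(2, ℝ)) (MulAction.toPermHom SL(2, ℝ) ℍ)
      center_le_ker_toPermHom)

/-- The class in `PSL(2, ℝ)` of a matrix of `SL(2, ℝ)` acts as the matrix does. -/
theorem psl_mk_smul (A : SL(2, ℝ)) (z : ℍ) :
    (QuotientGroup.mk A : PSL(2, ℝ)) • z = A • z := rfl

/-! ### Types of isometries (the conditions do not depend on the lift `± A`) -/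

/-- `h` is elliptic: `|tr| < 2`, i.e. negative discriminant. -/
def PSLElliptic (h : PSL(2, ℝ)) : Prop :=
  ∃ A : SL(2, ℝ), (QuotientGroup.mk A : PSL(2, ℝ)) = h ∧ A.1.IsElliptic

/-- `h` is parabolic: nontrivial with `|tr| = 2`. -/
def PSLParabolic (h : PSL(2, ℝ)) : Prop :=
  ∃ A : SL(2, ℝ), (QuotientGroup.mk A : PSL(2, ℝ)) = h ∧ A.1.IsParabolic

/-- `h` is hyperbolic: `|tr| > 2`, i.e. positive discriminant. -/
def PSLHyperbolic (h : PSL(2, ℝ)) : Prop :=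
  ∃ A : SL(2, ℝ), (QuotientGroup.mk A : PSL(2, ℝ)) = h ∧ A.1.IsHyperbolic

/-- The ideal point `ξ = [v]` is an attracting fixed point of `h`: `v` is an eigenvector of `h`
for an eigenvalue `μ` with `|μ| > 1` (so that the derivative of `h` at `ξ` is `μ⁻² < 1`). -/
def IsAttractingFixedPoint (h : PSL(2, ℝ)) (ξ : ℙ ℝ (Fin 2 → ℝ)) : Prop :=
  ∃ A : SL(2, ℝ), (QuotientGroup.mk A : PSL(2, ℝ)) = h ∧
    ∃ μ : ℝ, 1 < |μ| ∧ A.1.mulVec ξ.rep = μ • ξ.rep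

/-! ### Geodesic lines and transverse orientations -/

/-- The geodesic lines of `ℍ` are the images of the imaginary axis under orientation-preserving
isometries. -/
def IsGeodesicLine (m : Set ℍ) : Prop :=
  ∃ g : PSL(2, ℝ), m = g • {z : ℍ | z.re = 0}

/-- A geodesic line of `ℍ` with a transverse orientation, i.e. the choice of one (`pos`) of the two
open half-planes that it bounds. Both half-planes bounded by the imaginary axis occur, since the
half-turn `z ↦ -1 / z` preserves that axis and exchanges the two. -/
structure OrientedGeodesic where
  line : Set ℍ
  pos : Set ℍ
  exists_smul : ∃ g : PSL(2, ℝ), line = g • {z : ℍ | z.re = 0} ∧ pos = g • {z : ℍ | 0 < z.re}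

/-- The image of a transversely oriented geodesic line under an isometry, with the induced
transverse orientation. -/
instance : SMul PSL(2, ℝ) OrientedGeodesic where
  smul h L :=
    { line := h • L.line
      pos := h • L.pos
      exists_smul := by
        obtain ⟨g, h1, h2⟩ := L.exists_smul
        exact ⟨h * g, by rw [h1, mul_smul], by rw [h2, mul_smul]⟩ }

/-- Two disjoint transversely oriented geodesic lines are oriented away from each other: each lies
(strictly) on the negative side of the other. -/
def AwayFromEachOther (L L' : OrientedGeodesic) : Prop :=
  L'.line ⊆ (L.line ∪ L.pos)ᶜ ∧ L.line ⊆ (L'.line ∪ L'.pos)ᶜ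

/-- The closure of a subset of `ℍ` in `ℍ ∪ ∂ℍ`. The latter is the closed upper half-plane of the
Riemann sphere `OnePoint ℂ`, a closed set, so the closure may be taken in the sphere. -/
def idealClosure (S : Set ℍ) : Set (OnePoint ℂ) :=
  closure ((fun z : ℍ => ((z : ℂ) : OnePoint ℂ)) '' S)

/-- An ideal point `[x : y]` of `∂ℍ = ℙ¹(ℝ)`, as the point `x / y` of the Riemann sphere. -/
def idealPoint (ξ : ℙ ℝ (Fin 2 → ℝ)) : OnePoint ℂ :=
  ((OnePoint.equivProjectivization ℝ).symm ξ).map (fun t : ℝ => (t : ℂ))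

/-- `ξ ∈ ∂ℍ` is an endpoint of the geodesic line `m`. -/
def IsEndpoint (ξ : ℙ ℝ (Fin 2 → ℝ)) (m : Set ℍ) : Prop :=
  idealPoint ξ ∈ idealClosure m

/-- The geodesic lines `m` and `n` are orthogonal: some orientation-preserving isometry takes the
unit half-circle and the imaginary axis to them. -/
def OrthogonalLines (m n : Set ℍ) : Prop :=
  ∃ g : PSL(2, ℝ), m = g • {z : ℍ | ‖(z : ℂ)‖ = 1} ∧ n = g • {z : ℍ | z.re = 0}

/-- `m` is the axis of the hyperbolic element `h`, i.e. the geodesic line that `h` preserves. -/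
def IsAxis (h : PSL(2, ℝ)) (m : Set ℍ) : Prop :=
  IsGeodesicLine m ∧ h • m = m

/-! ### Crooked planes and stem quadrants -/

/-- The left AdS crooked plane in `AdS³ = PSL(2, ℝ)` centered at the identity and associated with
the geodesic line `m`: the stem consists of the elliptic elements whose fixed point is on `m`, the
identity, and the parabolic elements fixing an endpoint of `m`; the wings consist of the hyperbolic
elements whose attracting fixed point is an endpoint of `m`. -/
def crookedPlane (m : Set ℍ) : Set PSL(2, ℝ) :=
  {h | PSLElliptic h ∧ ∃ z ∈ m, h • z = z} ∪ {1} ∪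
  {h | PSLParabolic h ∧ ∃ ξ, IsEndpoint ξ m ∧ h • ξ = ξ} ∪
  {h | PSLHyperbolic h ∧ ∃ ξ, IsEndpoint ξ m ∧ IsAttractingFixedPoint h ξ}

/-- The stem quadrant of `L`: the hyperbolic elements whose axis is orthogonal to the line and that
translate towards its positive side. -/
def stemQuadrant (L : OrientedGeodesic) : Set PSL(2, ℝ) :=
  {h | PSLHyperbolic h ∧ ∃ m, IsAxis h m ∧ OrthogonalLines m L.line ∧
    ∀ p ∈ m ∩ L.line, h • p ∈ L.pos}

/-- The projective span of a set `S` in `AdS³ = PSL(2, ℝ)`, seen as an open subset of the projective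
space of `M₂(ℝ)`. For a stem quadrant this is the (timelike) plane of `AdS³` that contains it. -/
def projSpan (S : Set PSL(2, ℝ)) : Set PSL(2, ℝ) :=
  {h | ∃ A : SL(2, ℝ), (QuotientGroup.mk A : PSL(2, ℝ)) = h ∧
    A.1 ∈ Submodule.span ℝ {M : Matrix (Fin 2) (Fin 2) ℝ |
      ∃ B : SL(2, ℝ), (QuotientGroup.mk B : PSL(2, ℝ)) ∈ S ∧ B.1 = M}}

/-- The boundary of the stem quadrant of `L` in the timelike plane of `AdS³` that contains it. -/
def stemQuadrantBoundary (L : OrientedGeodesic) : Set PSL(2, ℝ) :=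
  Subtype.val ''
    frontier (Subtype.val ⁻¹' stemQuadrant L : Set (projSpan (stemQuadrant L)))

/-- The set of `h` with `inf (d(x, h • x') - d(x, x')) > 0`, for `x`, `x'` in the two given lines. -/
def lengtheningSet (m m' : Set ℍ) : Set PSL(2, ℝ) :=
  {h | ∃ K : ℝ, 0 < K ∧ ∀ x ∈ m, ∀ x' ∈ m', K ≤ dist x (h • x') - dist x x'}

/-- The elements `h` of the previous set such that the line of `L` and the image under `h` of that
of `L'`, with the transverse orientations given by `L` and by `L'` via `h`, are oriented away from
each other. -/
def awayComponent (L L' : OrientedGeodesic) : Set PSL(2, ℝ) :=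
  {h | h ∈ lengtheningSet L.line L'.line ∧ AwayFromEachOther L (h • L')}

end

/-! Take `G`, `G'` carrying the imaginary axis to the two lines, put `n = G⁻¹ * G'` and write `h = G
N G'⁻¹`. The identity corresponds to `N = n`, and disjointness of the closures makes every entry of
`n` nonzero. The theorem then becomes a comparison of the entries of `N` and `n`.

Lengthening: up to a factor `2st`, the cosh of the distance from `is` to `N • it` is a polynomial in
`s²`, `t²` whose coefficients are the squared entries of `N`. So distances grow by a uniform amount
exactly when each entry of `N` exceeds that of `n` in absolute value (`mk_mem_lengtheningSet_iff`).

Crooked planes: a common point is a relation `X n = ± N Y` with `X`, `Y` in the crooked plane of the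
imaginary axis. Such matrices multiply a nonzero nonnegative diagonal form by a factor at most 1, so
a weighted sum of squared entries does not grow from `n` to `N` (`not_entriesExceed_of_isCrooked`).
Conversely, if an entry in column `j` does not grow, some crooked `X` takes column `j` of `n` to `ν`
times column `j` of `N` with `|ν| ≥ 1`, and `N⁻¹ X n` is crooked because a basis vector is an
eigenvector for `ν` (`exists_isCrooked_of_not_entriesExceed`).

Factorization: orientation away from each other fixes the signs of `N` up to a global sign. Stem
matrices have equal diagonal entries and off-diagonal entries of the same sign as these; boundary
elements are unipotent shears `S`. Equality of the diagonal entries of `n S N⁻¹` is a linear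
equation determining `S`, and the off-diagonal entries are then positive because the entries of `N`
exceed those of `n` (`isStem_entries_of_dominates`). This gives the continuous inverse of the
product map, hence also connectedness. Maximality holds because no entry of `N` vanishes on the
lengthening set, so signs cannot change. The second product map follows from the first by inversion.
-/

noncomputable section

-- Matrices of SL(2, ℝ), their classes and isometry types

local notation "π" => (QuotientGroup.mk : SL(2, ℝ) → PSL(2, ℝ))

/-- The imaginary axis. -/
def imagAxis : Set ℍ := {z : ℍ | z.re = 0}

/-- The half-plane of positive real parts. -/
def rightHalf : Set ℍ := {z : ℍ | 0 < z.re}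

theorem SL2.det_eq (A : SL(2, ℝ)) : A 0 0 * A 1 1 - A 0 1 * A 1 0 = 1 := by
  rw [← Matrix.det_fin_two]; exact A.2

theorem SL2.ext_iff {A B : SL(2, ℝ)} :
    A = B ↔ A 0 0 = B 0 0 ∧ A 0 1 = B 0 1 ∧ A 1 0 = B 1 0 ∧ A 1 1 = B 1 1 := by
  constructor
  · rintro rfl; simp
  · rintro ⟨h1, h2, h3, h4⟩
    ext i j
    fin_cases i <;> fin_cases j <;> assumption

theorem SL2.mul_apply (A B : SL(2, ℝ)) (i j : Fin 2) :
    (A * B) i j = A i 0 * B 0 j + A i 1 * B 1 j := by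
  simp [Matrix.mul_apply]

theorem SL2.inv_apply (A : SL(2, ℝ)) :
    A⁻¹ 0 0 = A 1 1 ∧ A⁻¹ 0 1 = -A 0 1 ∧ A⁻¹ 1 0 = -A 1 0 ∧ A⁻¹ 1 1 = A 0 0 := by
  simp [Matrix.SpecialLinearGroup.coe_inv, Matrix.adjugate_fin_two]

theorem SL2.trace_conj (G A : SL(2, ℝ)) :
    (G * A * G⁻¹) 0 0 + (G * A * G⁻¹) 1 1 = A 0 0 + A 1 1 := by
  obtain ⟨h1, h2, h3, h4⟩ := SL2.inv_apply G
  simp only [SL2.mul_apply, h1, h2, h3, h4]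
  linear_combination (A 0 0 + A 1 1) * SL2.det_eq G

theorem SL2.neg_apply (A : SL(2, ℝ)) (i j : Fin 2) : (-A) i j = -A i j := by simp

/-- The matrix of `SL(2, ℝ)` with the given entries. -/
def SL2.of (a b c d : ℝ) (h : a * d - b * c = 1) : SL(2, ℝ) :=
  ⟨!![a, b; c, d], by rw [Matrix.det_fin_two_of, h]⟩

section
variable {a b c d : ℝ} (h : a * d - b * c = 1)
@[simp] theorem SL2.of_00 : SL2.of a b c d h 0 0 = a := rfl
@[simp] theorem SL2.of_01 : SL2.of a b c d h 0 1 = b := rfl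
@[simp] theorem SL2.of_10 : SL2.of a b c d h 1 0 = c := rfl
@[simp] theorem SL2.of_11 : SL2.of a b c d h 1 1 = d := rfl
end

theorem PSL.mk_eq_mk_iff {A B : SL(2, ℝ)} : π A = π B ↔ A = B ∨ A = -B := by
  rw [QuotientGroup.eq, Matrix.SpecialLinearGroup.mem_center_iff]
  constructor
  · rintro ⟨r, hr, hrA⟩
    have hB : B = A * (A⁻¹ * B) := by group
    have key : ∀ i j, B i j = r * A i j := by
      intro i j
      have h : B.1 = A.1 * (A⁻¹ * B).1 := by
        rw [← Matrix.SpecialLinearGroup.coe_mul, ← hB]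
      rw [h, ← hrA]
      simp [mul_comm]
    have hr2 : r ^ 2 = 1 := by simpa using hr
    rcases mul_self_eq_one_iff.mp (by rwa [sq] at hr2) with rfl | rfl
    all_goals simp_all [SL2.ext_iff]
  · rintro (rfl | rfl)
    · exact ⟨1, by simp, by simp⟩
    · exact ⟨-1, by simp, by ext i j; fin_cases i <;> fin_cases j <;> simp⟩

theorem PSL.mk_neg (A : SL(2, ℝ)) : π (-A) = π A := PSL.mk_eq_mk_iff.mpr (Or.inr rfl)

/-- The only lifts are `± A`, so a condition insensitive to sign can be tested on any lift. -/
theorem PSL.exists_mk_and_iff {A : SL(2, ℝ)} {p : SL(2, ℝ) → Prop} (hp : ∀ B, p (-B) ↔ p B) :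
    (∃ B, π B = π A ∧ p B) ↔ p A := by
  constructor
  · rintro ⟨B, hB, h⟩
    rcases PSL.mk_eq_mk_iff.mp hB with rfl | rfl
    · exact h
    · exact (hp A).mp h
  · exact fun h => ⟨A, rfl, h⟩

theorem SL2.discr_eq (A : SL(2, ℝ)) : A.1.discr = (A 0 0 + A 1 1) ^ 2 - 4 := by
  rw [Matrix.discr_fin_two, A.2, Matrix.trace_fin_two]; ring

theorem PSLElliptic_mk {A : SL(2, ℝ)} : PSLElliptic (π A) ↔ (A 0 0 + A 1 1) ^ 2 < 4 := by
  rw [PSLElliptic, PSL.exists_mk_and_iff (p := fun B => B.1.IsElliptic)]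
  · rw [Matrix.IsElliptic, SL2.discr_eq, sub_neg]
  · intro B
    simp only [Matrix.IsElliptic, SL2.discr_eq, SL2.neg_apply]
    ring_nf

theorem PSLHyperbolic_mk {A : SL(2, ℝ)} : PSLHyperbolic (π A) ↔ 4 < (A 0 0 + A 1 1) ^ 2 := by
  rw [PSLHyperbolic, PSL.exists_mk_and_iff (p := fun B => B.1.IsHyperbolic)]
  · rw [Matrix.IsHyperbolic, SL2.discr_eq, sub_pos]
  · intro B
    simp only [Matrix.IsHyperbolic, SL2.discr_eq, SL2.neg_apply]
    ring_nf

theorem PSLParabolic_mk {A : SL(2, ℝ)} :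
    PSLParabolic (π A) ↔ π A ≠ 1 ∧ (A 0 0 + A 1 1) ^ 2 = 4 := by
  rw [PSLParabolic, PSL.exists_mk_and_iff (p := fun B => B.1.IsParabolic)]
  · rw [Matrix.IsParabolic, SL2.discr_eq, sub_eq_zero]
    refine and_congr_left fun htr => not_congr ?_
    rw [show (1 : PSL(2, ℝ)) = π 1 from rfl, PSL.mk_eq_mk_iff]
    constructor
    · rintro ⟨r, hr⟩
      have h : ∀ i j, A i j = Matrix.scalar (Fin 2) r i j := fun i j => by rw [hr]
      have h00 := h 0 0
      have h01 := h 0 1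
      have h10 := h 1 0
      have h11 := h 1 1
      simp at h00 h01 h10 h11
      have : r ^ 2 = 1 := by rw [h00, h11] at htr; nlinarith
      rcases mul_self_eq_one_iff.mp (by rwa [sq] at this) with rfl | rfl
      · left; simp [SL2.ext_iff, h00, h01, h10, h11]
      · right; simp [SL2.ext_iff, h00, h01, h10, h11]
    · rintro (rfl | rfl)
      · exact ⟨1, by simp⟩
      · exact ⟨-1, by ext i j; fin_cases i <;> fin_cases j <;> simp⟩
  · intro B
    simp [Matrix.isParabolic_neg_iff]

theorem PSL.mk_conj_mk (G X : SL(2, ℝ)) : π G * π X * (π G)⁻¹ = π (G * X * G⁻¹) := rfl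

/-! ### The Möbius action in real coordinates -/

theorem SL2.denom_ne_zero (A : SL(2, ℝ)) (z : ℍ) : (A 1 0 : ℂ) * z + A 1 1 ≠ 0 := by
  intro h
  have him := congrArg Complex.im h
  have hre := congrArg Complex.re h
  simp at him hre
  have hd := SL2.det_eq A
  rcases him with h0 | h0
  · rw [h0] at hre hd; simp at hre; rw [hre] at hd; simp at hd
  · exact z.im_pos.ne' h0

theorem SL2.coe_smul (A : SL(2, ℝ)) (z : ℍ) :
    ((A • z : ℍ) : ℂ) = ((A 0 0 : ℂ) * z + A 0 1) / ((A 1 0 : ℂ) * z + A 1 1) := by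
  rw [UpperHalfPlane.coe_specialLinearGroup_apply]; rfl

/-- The square of the modulus of the denominator of a Möbius transformation. -/
def SL2.den (A : SL(2, ℝ)) (z : ℍ) : ℝ := (A 1 0 * z.re + A 1 1) ^ 2 + (A 1 0 * z.im) ^ 2

theorem SL2.den_eq (A : SL(2, ℝ)) (z : ℍ) :
    SL2.den A z = Complex.normSq ((A 1 0 : ℂ) * z + A 1 1) := by
  simp [SL2.den, Complex.normSq_apply]; ring

theorem SL2.den_pos (A : SL(2, ℝ)) (z : ℍ) : 0 < SL2.den A z := by
  rw [SL2.den_eq]; exact Complex.normSq_pos.mpr (SL2.denom_ne_zero A z)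

theorem SL2.re_smul (A : SL(2, ℝ)) (z : ℍ) :
    (A • z).re = (A 0 0 * A 1 0 * (z.re ^ 2 + z.im ^ 2) +
      (A 0 0 * A 1 1 + A 0 1 * A 1 0) * z.re + A 0 1 * A 1 1) / SL2.den A z := by
  rw [← UpperHalfPlane.coe_re, SL2.coe_smul, Complex.div_re, ← SL2.den_eq, ← add_div]
  congr 1
  simp
  ring

theorem SL2.im_smul (A : SL(2, ℝ)) (z : ℍ) : (A • z).im = z.im / SL2.den A z := by
  rw [← UpperHalfPlane.coe_im, SL2.coe_smul, Complex.div_im, ← SL2.den_eq, ← sub_div]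
  congr 1
  simp
  linear_combination z.im * SL2.det_eq A

/-- The point `i y` of the imaginary axis. -/
def imagPoint (y : ℝ) (hy : 0 < y) : ℍ := ⟨⟨0, y⟩, hy⟩

@[simp] theorem imagPoint_re (y : ℝ) (hy : 0 < y) : (imagPoint y hy).re = 0 := rfl
@[simp] theorem imagPoint_im (y : ℝ) (hy : 0 < y) : (imagPoint y hy).im = y := rfl

theorem imagPoint_mem (y : ℝ) (hy : 0 < y) : imagPoint y hy ∈ imagAxis := rfl

theorem mem_imagAxis {z : ℍ} : z ∈ imagAxis ↔ z.re = 0 := Iff.rfl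
theorem mem_rightHalf {z : ℍ} : z ∈ rightHalf ↔ 0 < z.re := Iff.rfl

theorem mem_mk_smul_set {G : SL(2, ℝ)} {S : Set ℍ} {z : ℍ} : z ∈ π G • S ↔ G⁻¹ • z ∈ S := by
  rw [Set.mem_smul_set_iff_inv_smul_mem]; rfl

/-! ### Endpoints of geodesic lines and fixed points -/

theorem OnePoint.infty_mem_closure_image_iff {X : Type*} [PseudoMetricSpace X] [ProperSpace X]
    {T : Set X} :
    OnePoint.infty ∈ closure ((fun x : X => (x : OnePoint X)) '' T) ↔ ¬ Bornology.IsBounded T := by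
  constructor
  · intro h hb
    have hK : IsCompact (closure T) := hb.isCompact_closure
    have hc : IsClosed (((↑) : X → OnePoint X) '' closure T) :=
      OnePoint.isClosed_image_coe.mpr ⟨isClosed_closure, hK⟩
    have := closure_minimal (Set.image_mono subset_closure) hc h
    exact OnePoint.infty_notMem_image_coe this
  · intro h
    by_contra hc
    apply h
    have ho : IsOpen (closure ((fun x : X => (x : OnePoint X)) '' T))ᶜ := isClosed_closure.isOpen_compl
    have h2 := (OnePoint.isOpen_iff_of_mem (s := (closure ((fun x : X => (x : OnePoint X)) '' T))ᶜ)
      hc).mp ho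
    refine h2.2.isBounded.subset ?_
    intro x hx
    simp only [Set.mem_compl_iff, Set.mem_preimage, not_not]
    exact subset_closure ⟨x, hx, rfl⟩

/-- An ideal point `[v]` is in the ideal closure of `S` iff its chordal distance to `S` is zero. -/
theorem idealPoint_mem_idealClosure_iff {v : Fin 2 → ℝ} (hv : v ≠ 0) {S : Set ℍ} :
    idealPoint (Projectivization.mk ℝ v hv) ∈ idealClosure S ↔
      ∀ ε : ℝ, 0 < ε → ∃ z ∈ S, (v 1 * z.re - v 0) ^ 2 + (v 1 * z.im) ^ 2 <
        ε * (1 + z.re ^ 2 + z.im ^ 2) := by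
  have himg : (fun z : ℍ => ((z : ℂ) : OnePoint ℂ)) '' S =
      (fun x : ℂ => (x : OnePoint ℂ)) '' ((fun z : ℍ => (z : ℂ)) '' S) := by
    rw [Set.image_image]
  rw [idealPoint, OnePoint.equivProjectivization_symm_apply_mk, idealClosure, himg]
  have hns : ∀ z : ℍ, ‖(z : ℂ)‖ ^ 2 = z.re ^ 2 + z.im ^ 2 := by
    intro z
    rw [← Complex.normSq_eq_norm_sq, Complex.normSq_apply]; simp [sq]
  by_cases h1 : v 1 = 0
  · have h0 : v 0 ≠ 0 := by
      intro h0; apply hv; ext i; fin_cases i <;> assumption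
    rw [if_pos h1, OnePoint.map_infty, OnePoint.infty_mem_closure_image_iff]
    constructor
    · intro hb ε hε
      by_contra! hcon
      apply hb
      refine (isBounded_iff_forall_norm_le).mpr ⟨√ (v 0 ^ 2 / ε), ?_⟩
      rintro _ ⟨z, hz, rfl⟩
      apply Real.le_sqrt_of_sq_le
      rw [hns, le_div_iff₀ hε]
      have := hcon z hz
      rw [h1] at this
      nlinarith
    · intro h hb
      obtain ⟨R, hR⟩ := isBounded_iff_forall_norm_le.mp hb
      have hpos : 0 < v 0 ^ 2 := by positivity
      obtain ⟨z, hz, hlt⟩ := h (v 0 ^ 2 / (1 + R ^ 2)) (by positivity)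
      have h2 := hR _ ⟨z, hz, rfl⟩
      have h3 : ‖(z : ℂ)‖ ^ 2 ≤ R ^ 2 := pow_le_pow_left₀ (norm_nonneg _) h2 2
      rw [hns] at h3
      rw [h1, div_mul_eq_mul_div, lt_div_iff₀ (by positivity)] at hlt
      nlinarith
  · rw [if_neg h1, OnePoint.map_some]
    have := (OnePoint.isOpenEmbedding_coe (X := ℂ)).isInducing.closure_eq_preimage_closure_image
      ((fun z : ℍ => (z : ℂ)) '' S)
    have h2 : ((((v 1)⁻¹ * v 0 : ℝ) : ℂ) : OnePoint ℂ) ∈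
        closure ((fun x : ℂ => (x : OnePoint ℂ)) '' ((fun z : ℍ => (z : ℂ)) '' S)) ↔
        (((v 1)⁻¹ * v 0 : ℝ) : ℂ) ∈ closure ((fun z : ℍ => (z : ℂ)) '' S) := by
      rw [this]; rfl
    rw [h2, Metric.mem_closure_iff]
    have hd : ∀ z : ℍ, v 1 ^ 2 * dist (((v 1)⁻¹ * v 0 : ℝ) : ℂ) (z : ℂ) ^ 2 =
        (v 1 * z.re - v 0) ^ 2 + (v 1 * z.im) ^ 2 := by
      intro z
      rw [Complex.dist_eq, ← Complex.normSq_eq_norm_sq, Complex.normSq_apply]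
      simp
      field_simp
      ring
    have hp : 0 < v 1 ^ 2 := by positivity
    constructor
    · intro h ε hε
      obtain ⟨_, ⟨z, hz, rfl⟩, hlt⟩ := h (√ (ε / v 1 ^ 2)) (by positivity)
      refine ⟨z, hz, ?_⟩
      rw [← hd]
      have h3 := (Real.lt_sqrt dist_nonneg).mp hlt
      rw [lt_div_iff₀ hp] at h3
      nlinarith [sq_nonneg z.re, sq_nonneg z.im]
    · intro h ε hε
      set x := (v 1)⁻¹ * v 0 with hx
      have hM : 0 < 1 + 2 * x ^ 2 := by positivity
      -- Here `1 + |z|² ≤ (1 + 2x²) + 2d²` with `d` the distance to `x`. The bound `1/4` lets the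
      -- `2d²` term be absorbed as `d²/2`; the other bound leaves at most `ε²/2`.
      obtain ⟨z, hz, hlt⟩ := h (v 1 ^ 2 * min (1 / 4) (ε ^ 2 / (2 * (1 + 2 * x ^ 2)))) (by positivity)
      refine ⟨_, ⟨z, hz, rfl⟩, ?_⟩
      rw [← hd, mul_assoc] at hlt
      have hlt' := lt_of_mul_lt_mul_left hlt hp.le
      have hdd : dist (x : ℂ) (z : ℂ) ^ 2 = (x - z.re) ^ 2 + z.im ^ 2 := by
        rw [Complex.dist_eq, ← Complex.normSq_eq_norm_sq, Complex.normSq_apply]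
        simp; ring
      have hle : 1 + z.re ^ 2 + z.im ^ 2 ≤ (1 + 2 * x ^ 2) + 2 * dist (x : ℂ) (z : ℂ) ^ 2 := by
        rw [hdd]; nlinarith [sq_nonneg (2 * x - z.re), sq_nonneg z.im]
      have hm0 : 0 < min (1 / 4) (ε ^ 2 / (2 * (1 + 2 * x ^ 2))) := by positivity
      have hm1 := min_le_left (1 / 4) (ε ^ 2 / (2 * (1 + 2 * x ^ 2)))
      have hm2 := min_le_right (1 / 4) (ε ^ 2 / (2 * (1 + 2 * x ^ 2)))
      rw [le_div_iff₀ (by positivity)] at hm2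
      have hfin : dist (x : ℂ) (z : ℂ) ^ 2 < ε ^ 2 := by
        nlinarith [mul_le_mul_of_nonneg_left hle hm0.le,
          mul_le_mul_of_nonneg_right hm1 (sq_nonneg (dist (x : ℂ) (z : ℂ)))]
      exact lt_of_pow_lt_pow_left₀ 2 hε.le hfin

/-- The endpoints are the images of `0` and `∞`, so `G⁻¹ v = (u, w)` must lie on a coordinate axis.
At `G • iy` the squared chordal quantity is `(w²y² + u²) / ((a² + c²)y² + (b² + d²))`, whose infimum
over `y > 0` vanishes iff `u = 0` (as `y → 0`) or `w = 0` (as `y → ∞`). -/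
theorem isEndpoint_smul_imagAxis_iff {v : Fin 2 → ℝ} (hv : v ≠ 0) {G : SL(2, ℝ)} :
    IsEndpoint (Projectivization.mk ℝ v hv) (π G • imagAxis) ↔
      (G⁻¹ 0 0 * v 0 + G⁻¹ 0 1 * v 1) * (G⁻¹ 1 0 * v 0 + G⁻¹ 1 1 * v 1) = 0 := by
  obtain ⟨i1, i2, i3, i4⟩ := SL2.inv_apply G
  rw [IsEndpoint, idealPoint_mem_idealClosure_iff, i1, i2, i3, i4]
  set a := G 0 0
  set b := G 0 1
  set c := G 1 0
  set d := G 1 1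
  have hdet : a * d - b * c = 1 := SL2.det_eq G
  set u := d * v 0 + -b * v 1 with hu
  set w := -c * v 0 + a * v 1 with hw
  have hv0 : v 0 = a * u + b * w := by rw [hu, hw]; linear_combination (-v 0) * hdet
  have hv1 : v 1 = c * u + d * w := by rw [hu, hw]; linear_combination (-v 1) * hdet
  have hac : 0 < a ^ 2 + c ^ 2 := by
    rcases eq_or_ne a 0 with h | h
    · have : c ≠ 0 := by rintro h'; rw [h, h'] at hdet; simp at hdet
      positivity
    · positivity
  have hbd : 0 < b ^ 2 + d ^ 2 := by
    rcases eq_or_ne b 0 with h | h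
    · have : d ≠ 0 := by rintro h'; rw [h, h'] at hdet; simp at hdet
      positivity
    · positivity
  have key : ∀ ε : ℝ, (∃ z ∈ π G • imagAxis, (v 1 * z.re - v 0) ^ 2 + (v 1 * z.im) ^ 2 <
        ε * (1 + z.re ^ 2 + z.im ^ 2)) ↔
      ∃ y : ℝ, 0 < y ∧ w ^ 2 * y ^ 2 + u ^ 2 < ε * ((a ^ 2 + c ^ 2) * y ^ 2 + (b ^ 2 + d ^ 2)) := by
    intro ε
    have hz : ∀ z : ℍ, z.re = 0 → ((v 1 * (G • z).re - v 0) ^ 2 + (v 1 * (G • z).im) ^ 2 <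
        ε * (1 + (G • z).re ^ 2 + (G • z).im ^ 2) ↔
        w ^ 2 * z.im ^ 2 + u ^ 2 < ε * ((a ^ 2 + c ^ 2) * z.im ^ 2 + (b ^ 2 + d ^ 2))) := by
      intro z hz
      have hD := SL2.den_pos G z
      have hDe : SL2.den G z = d ^ 2 + c ^ 2 * z.im ^ 2 := by rw [SL2.den, hz]; ring
      have e1 : (v 1 * (G • z).re - v 0) ^ 2 + (v 1 * (G • z).im) ^ 2 =
          (w ^ 2 * z.im ^ 2 + u ^ 2) / SL2.den G z := by
        rw [SL2.re_smul, SL2.im_smul, hz, hv0, hv1, eq_div_iff hD.ne']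
        field_simp
        rw [hDe]
        change ((c * u + d * w) * (a * c * (0 ^ 2 + z.im ^ 2) + 0 * (a * d + c * b) + d * b) -
          (d ^ 2 + c ^ 2 * z.im ^ 2) * (u * a + w * b)) ^ 2 + (c * u + d * w) ^ 2 * z.im ^ 2 =
          (d ^ 2 + c ^ 2 * z.im ^ 2) * (w ^ 2 * z.im ^ 2 + u ^ 2)
        have : (c * u + d * w) * (a * c * (0 ^ 2 + z.im ^ 2) + 0 * (a * d + c * b) + d * b) -
          (d ^ 2 + c ^ 2 * z.im ^ 2) * (u * a + w * b) = c * w * z.im ^ 2 - d * u := by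
          linear_combination (c * w * z.im ^ 2 - d * u) * hdet
        rw [this]
        ring
      have e2 : 1 + (G • z).re ^ 2 + (G • z).im ^ 2 =
          ((a ^ 2 + c ^ 2) * z.im ^ 2 + (b ^ 2 + d ^ 2)) / SL2.den G z := by
        rw [SL2.re_smul, SL2.im_smul, hz, eq_div_iff hD.ne']
        field_simp
        rw [hDe]
        change (d ^ 2 + c ^ 2 * z.im ^ 2) ^ 2 +
          (a * c * (0 ^ 2 + z.im ^ 2) + 0 * (a * d + c * b) + d * b) ^ 2 + z.im ^ 2 =
          (d ^ 2 + c ^ 2 * z.im ^ 2) * (z.im ^ 2 * (a ^ 2 + c ^ 2) + (b ^ 2 + d ^ 2))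
        linear_combination (-(a * d - b * c + 1)) * z.im ^ 2 * hdet
      rw [e1, e2, mul_div_assoc', div_lt_div_iff_of_pos_right hD]
    constructor
    · rintro ⟨z, ⟨z', hz', rfl⟩, h⟩
      exact ⟨z'.im, z'.im_pos, (hz z' hz').mp h⟩
    · rintro ⟨y, hy, h⟩
      exact ⟨G • imagPoint y hy, ⟨_, imagPoint_mem y hy, rfl⟩, (hz (imagPoint y hy) rfl).mpr h⟩
  simp only [key]
  constructor
  · intro h
    by_contra hne
    obtain ⟨h1, h2⟩ := mul_ne_zero_iff.mp hne
    have hm : 0 < min (u ^ 2) (w ^ 2) := by positivity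
    obtain ⟨y, hy, hlt⟩ := h (min (u ^ 2) (w ^ 2) / (a ^ 2 + c ^ 2 + (b ^ 2 + d ^ 2))) (by positivity)
    rw [div_mul_eq_mul_div, lt_div_iff₀ (by positivity)] at hlt
    have m1 := min_le_left (u ^ 2) (w ^ 2)
    have m2 := min_le_right (u ^ 2) (w ^ 2)
    have hy2 : 0 < y ^ 2 := by positivity
    have : min (u ^ 2) (w ^ 2) * (y ^ 2 + 1) ≤ w ^ 2 * y ^ 2 + u ^ 2 := by nlinarith
    have h3 : min (u ^ 2) (w ^ 2) * ((a ^ 2 + c ^ 2) * y ^ 2 + (b ^ 2 + d ^ 2)) ≤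
      min (u ^ 2) (w ^ 2) * ((y ^ 2 + 1) * (a ^ 2 + c ^ 2 + (b ^ 2 + d ^ 2))) := by
      apply mul_le_mul_of_nonneg_left _ hm.le
      nlinarith [mul_pos hy2 hbd]
    have h4 := mul_le_mul_of_nonneg_right this
      (show 0 ≤ a ^ 2 + c ^ 2 + (b ^ 2 + d ^ 2) by positivity)
    linarith
  · intro h ε hε
    rcases mul_eq_zero.mp h with h0 | h0
    · rw [h0]
      refine ⟨√ (ε * (b ^ 2 + d ^ 2) / (w ^ 2 + 1)), by positivity, ?_⟩
      rw [Real.sq_sqrt (by positivity)]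
      have : w ^ 2 * (ε * (b ^ 2 + d ^ 2) / (w ^ 2 + 1)) < ε * (b ^ 2 + d ^ 2) := by
        rw [mul_div_assoc', div_lt_iff₀ (by positivity)]
        nlinarith [mul_pos hε hbd]
      have h5 : 0 ≤ ε * ((a ^ 2 + c ^ 2) * (ε * (b ^ 2 + d ^ 2) / (w ^ 2 + 1))) := by positivity
      linarith
    · rw [h0]
      refine ⟨√ ((u ^ 2 + 1) / (ε * (a ^ 2 + c ^ 2))), by positivity, ?_⟩
      rw [Real.sq_sqrt (by positivity)]
      have : ε * ((a ^ 2 + c ^ 2) * ((u ^ 2 + 1) / (ε * (a ^ 2 + c ^ 2))) ) = u ^ 2 + 1 := by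
        field_simp
      have h5 : 0 < ε * (b ^ 2 + d ^ 2) := by positivity
      linarith

theorem PSL.smul_mk_eq_self_iff {A : SL(2, ℝ)} {v : Fin 2 → ℝ} (hv : v ≠ 0) :
    π A • Projectivization.mk ℝ v hv = Projectivization.mk ℝ v hv ↔
      ∃ μ : ℝ, A.1.mulVec v = μ • v := by
  rw [Matrix.ProjectiveSpecialLinearGroup.smul_proj_mk, Projectivization.smul_mk,
    Projectivization.mk_eq_mk_iff']
  exact exists_congr fun μ => eq_comm

theorem isAttractingFixedPoint_mk_iff {A : SL(2, ℝ)} {v : Fin 2 → ℝ} (hv : v ≠ 0) :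
    IsAttractingFixedPoint (π A) (Projectivization.mk ℝ v hv) ↔
      ∃ μ : ℝ, 1 < |μ| ∧ A.1.mulVec v = μ • v := by
  have hrep : ∀ (B : SL(2, ℝ)) (μ : ℝ), B.1.mulVec (Projectivization.mk ℝ v hv).rep =
      μ • (Projectivization.mk ℝ v hv).rep ↔ B.1.mulVec v = μ • v := by
    intro B μ
    obtain ⟨r, hr⟩ := Projectivization.exists_smul_eq_mk_rep ℝ v hv
    rw [← hr, Units.smul_def, Matrix.mulVec_smul, smul_comm μ]
    exact smul_right_injective _ r.ne_zero |>.eq_iff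
  simp only [IsAttractingFixedPoint, hrep]
  rw [PSL.exists_mk_and_iff (p := fun B : SL(2, ℝ) => ∃ μ : ℝ, 1 < |μ| ∧ B.1.mulVec v = μ • v)]
  intro B
  constructor
  all_goals
    rintro ⟨μ, h1, h2⟩
    refine ⟨-μ, by rwa [abs_neg], ?_⟩
    simp only [Matrix.SpecialLinearGroup.coe_neg, Matrix.neg_mulVec, neg_smul] at h2 ⊢
    simp [← h2]

theorem SL2.inv_mulVec_mulVec (G : SL(2, ℝ)) (v : Fin 2 → ℝ) :
    (G⁻¹).1.mulVec (G.1.mulVec v) = v := by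
  rw [Matrix.mulVec_mulVec, ← Matrix.SpecialLinearGroup.coe_mul, inv_mul_cancel,
    Matrix.SpecialLinearGroup.coe_one, Matrix.one_mulVec]

theorem SL2.conj_mulVec_eq_smul_iff {G X : SL(2, ℝ)} {v : Fin 2 → ℝ} {μ : ℝ} :
    (G * X * G⁻¹).1.mulVec (G.1.mulVec v) = μ • G.1.mulVec v ↔ X.1.mulVec v = μ • v := by
  have h1 : (G * X * G⁻¹).1.mulVec (G.1.mulVec v) = G.1.mulVec (X.1.mulVec v) := by
    rw [Matrix.mulVec_mulVec, Matrix.mulVec_mulVec, ← Matrix.SpecialLinearGroup.coe_mul,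
      ← Matrix.SpecialLinearGroup.coe_mul, inv_mul_cancel_right]
  rw [h1, ← Matrix.mulVec_smul]
  constructor
  · intro h
    have := congrArg (G⁻¹).1.mulVec h
    rwa [SL2.inv_mulVec_mulVec, SL2.inv_mulVec_mulVec] at this
  · intro h; rw [h]

theorem SL2.mulVec_ne_zero (G : SL(2, ℝ)) {v : Fin 2 → ℝ} (hv : v ≠ 0) : G.1.mulVec v ≠ 0 := by
  intro h
  have := congrArg (G⁻¹).1.mulVec h
  rw [SL2.inv_mulVec_mulVec, Matrix.mulVec_zero] at this
  exact hv this

theorem isEndpoint_mulVec_iff {G : SL(2, ℝ)} {v : Fin 2 → ℝ} (hv : v ≠ 0) :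
    IsEndpoint (Projectivization.mk ℝ (G.1.mulVec v) (SL2.mulVec_ne_zero G hv)) (π G • imagAxis) ↔
      v 0 * v 1 = 0 := by
  rw [isEndpoint_smul_imagAxis_iff]
  obtain ⟨i1, i2, i3, i4⟩ := SL2.inv_apply G
  rw [i1, i2, i3, i4, Matrix.mulVec_fin_two]
  have hdet := SL2.det_eq G
  have e1 : G 1 1 * (G 0 0 * v 0 + G 0 1 * v 1) + -G 0 1 * (G 1 0 * v 0 + G 1 1 * v 1) = v 0 := by
    linear_combination v 0 * hdet
  have e2 : -G 1 0 * (G 0 0 * v 0 + G 0 1 * v 1) + G 0 0 * (G 1 0 * v 0 + G 1 1 * v 1) = v 1 := by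
    linear_combination v 1 * hdet
  simp only [Matrix.cons_val_zero, Matrix.cons_val_one]
  rw [e1, e2]

/-- Endpoints of the line `G • imagAxis` are the images of `0` and `∞`. -/
theorem exists_isEndpoint_iff {G : SL(2, ℝ)} {p : ℙ ℝ (Fin 2 → ℝ) → Prop} :
    (∃ ξ, IsEndpoint ξ (π G • imagAxis) ∧ p ξ) ↔
      (∃ (v : Fin 2 → ℝ) (hv : v ≠ 0), v 0 * v 1 = 0 ∧
        p (Projectivization.mk ℝ (G.1.mulVec v) (SL2.mulVec_ne_zero G hv))) := by
  constructor
  · rintro ⟨ξ, h1, h2⟩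
    induction ξ using Projectivization.ind with | _ w hw
    have hv : (G⁻¹).1.mulVec w ≠ 0 := SL2.mulVec_ne_zero G⁻¹ hw
    have hG : G.1.mulVec ((G⁻¹).1.mulVec w) = w := by
      rw [Matrix.mulVec_mulVec, ← Matrix.SpecialLinearGroup.coe_mul, mul_inv_cancel,
        Matrix.SpecialLinearGroup.coe_one, Matrix.one_mulVec]
    have hmk : Projectivization.mk ℝ w hw = Projectivization.mk ℝ
        (G.1.mulVec ((G⁻¹).1.mulVec w)) (SL2.mulVec_ne_zero G hv) := by
      congr 1; exact hG.symm
    rw [hmk] at h1 h2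
    exact ⟨_, hv, (isEndpoint_mulVec_iff hv).mp h1, h2⟩
  · rintro ⟨v, hv, h, hp⟩
    exact ⟨_, (isEndpoint_mulVec_iff hv).mpr h, hp⟩

/-- The predicate `q` on the eigenvalue serves both for fixed endpoints (no condition) and
attracting ones (`1 < |μ|`). -/
theorem exists_axis_eigenvector_iff {X : SL(2, ℝ)} {q : ℝ → Prop} :
    (∃ (v : Fin 2 → ℝ) (_ : v ≠ 0), v 0 * v 1 = 0 ∧ ∃ μ : ℝ, q μ ∧ X.1.mulVec v = μ • v) ↔
      (X 1 0 = 0 ∧ q (X 0 0)) ∨ (X 0 1 = 0 ∧ q (X 1 1)) := by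
  constructor
  · rintro ⟨v, hv, h, μ, hq, hμ⟩
    have e0 := congrFun hμ 0
    have e1 := congrFun hμ 1
    simp at e0 e1
    rcases mul_eq_zero.mp h with h0 | h0
    · have h1 : v 1 ≠ 0 := by
        intro h1; apply hv; ext i; fin_cases i <;> assumption
      simp only [h0, mul_zero, zero_add, mul_eq_zero, h1, or_false, mul_eq_mul_right_iff] at e0 e1
      exact Or.inr ⟨e0, e1 ▸ hq⟩
    · have h1 : v 0 ≠ 0 := by
        intro h1; apply hv; ext i; fin_cases i <;> assumption
      simp only [h0, mul_zero, add_zero, mul_eq_zero, h1, or_false, mul_eq_mul_right_iff] at e0 e1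
      exact Or.inl ⟨e1, e0 ▸ hq⟩
  · rintro (⟨h, hq⟩ | ⟨h, hq⟩)
    · refine ⟨![1, 0], by simp, by simp, _, hq, ?_⟩
      ext i; fin_cases i <;> simp [h]
    · refine ⟨![0, 1], by simp, by simp, _, hq, ?_⟩
      ext i; fin_cases i <;> simp [h]

theorem exists_fixed_endpoint_iff {G X : SL(2, ℝ)} :
    (∃ ξ, IsEndpoint ξ (π G • imagAxis) ∧ π (G * X * G⁻¹) • ξ = ξ) ↔ X 1 0 = 0 ∨ X 0 1 = 0 := by
  rw [exists_isEndpoint_iff]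
  simp only [PSL.smul_mk_eq_self_iff, SL2.conj_mulVec_eq_smul_iff]
  simpa using exists_axis_eigenvector_iff (X := X) (q := fun _ => True)

theorem exists_attracting_endpoint_iff {G X : SL(2, ℝ)} :
    (∃ ξ, IsEndpoint ξ (π G • imagAxis) ∧ IsAttractingFixedPoint (π (G * X * G⁻¹)) ξ) ↔
      (X 1 0 = 0 ∧ 1 < |X 0 0|) ∨ (X 0 1 = 0 ∧ 1 < |X 1 1|) := by
  rw [exists_isEndpoint_iff]
  simp only [isAttractingFixedPoint_mk_iff, SL2.conj_mulVec_eq_smul_iff]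
  exact exists_axis_eigenvector_iff

theorem exists_fixed_mem_line_iff {G X : SL(2, ℝ)} :
    (∃ z ∈ π G • imagAxis, π (G * X * G⁻¹) • z = z) ↔
      ∃ y : ℝ, 0 < y ∧ X 0 0 = X 1 1 ∧ X 0 1 = -X 1 0 * y ^ 2 := by
  have h1 : (∃ z ∈ π G • imagAxis, π (G * X * G⁻¹) • z = z) ↔ ∃ w ∈ imagAxis, X • w = w := by
    have : ∀ w : ℍ, π (G * X * G⁻¹) • π G • w = π G • w ↔ X • w = w := by
      intro w
      simp only [psl_mk_smul, mul_smul, inv_smul_smul, smul_left_cancel_iff]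
    constructor
    · rintro ⟨_, ⟨w, hw, rfl⟩, h⟩
      exact ⟨w, hw, (this w).mp h⟩
    · rintro ⟨w, hw, h⟩
      exact ⟨_, ⟨w, hw, rfl⟩, (this w).mpr h⟩
  have h2 : ∀ w ∈ imagAxis, X • w = w ↔ X 0 0 = X 1 1 ∧ X 0 1 = -X 1 0 * w.im ^ 2 := by
    intro w hw
    rw [mem_imagAxis] at hw
    rw [UpperHalfPlane.ext_iff, SL2.coe_smul, div_eq_iff (SL2.denom_ne_zero X w), Complex.ext_iff]
    simp [hw]
    have := w.im_pos.ne'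
    constructor
    · rintro ⟨e1, e2⟩
      exact ⟨mul_right_cancel₀ this (by linarith), by rw [e1]; ring⟩
    · rintro ⟨e1, e2⟩
      exact ⟨by rw [e2]; ring, by rw [e1]; ring⟩
  rw [h1]
  constructor
  · rintro ⟨w, hw, h⟩
    exact ⟨w.im, w.im_pos, (h2 w hw).mp h⟩
  · rintro ⟨y, hy, h⟩
    exact ⟨_, imagPoint_mem y hy, (h2 _ (imagPoint_mem y hy)).mpr h⟩

/-! ### The crooked plane in matrix form -/

/-- The matrices of the elements of the left crooked plane of the imaginary axis. -/
def IsCrooked (X : SL(2, ℝ)) : Prop :=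
  (X 0 0 = X 1 1 ∧ X 0 1 * X 1 0 ≤ 0) ∨ (X 1 0 = 0 ∧ 1 ≤ X 0 0 ^ 2) ∨ (X 0 1 = 0 ∧ 1 ≤ X 1 1 ^ 2)

/-- Elliptic elements fixing a point of the axis have equal diagonal entries and off-diagonal
entries of opposite signs; the identity and the parabolic elements are the limit case where the
off-diagonal product vanishes. The wings are triangular matrices with an expanding eigenvalue on a
coordinate axis. -/
theorem mk_conj_mem_crookedPlane_iff {G X : SL(2, ℝ)} :
    π (G * X * G⁻¹) ∈ crookedPlane (π G • imagAxis) ↔ IsCrooked X := by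
  have hone : π (G * X * G⁻¹) = 1 ↔ X = 1 ∨ X = -1 := by
    rw [← PSL.mk_conj_mk, conj_eq_one_iff, show (1 : PSL(2, ℝ)) = π 1 from rfl, PSL.mk_eq_mk_iff]
  simp only [crookedPlane, Set.mem_union, Set.mem_ofPred_eq, Set.mem_singleton_iff, PSLElliptic_mk,
    PSLParabolic_mk, PSLHyperbolic_mk, SL2.trace_conj, exists_fixed_mem_line_iff, hone, ne_eq,
    exists_fixed_endpoint_iff, exists_attracting_endpoint_iff, IsCrooked]
  have hdet := SL2.det_eq X
  simp only [SL2.ext_iff, SL2.neg_apply]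
  simp only [Matrix.SpecialLinearGroup.coe_one, Matrix.one_apply_eq, ne_eq, zero_ne_one,
    not_false_eq_true, Matrix.one_apply_ne, one_ne_zero, neg_zero]
  simp only [← one_lt_sq_iff_one_lt_abs]
  generalize X 0 0 = a at *
  generalize X 0 1 = b at *
  generalize X 1 0 = c at *
  generalize X 1 1 = d at *
  constructor
  · rintro (((⟨-, y, hy, rfl, rfl⟩ | h) | ⟨⟨-, h⟩, h2⟩) | ⟨-, h⟩)
    · left; exact ⟨rfl, by nlinarith [mul_nonneg (sq_nonneg c) (sq_nonneg y)]⟩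
    · left; rcases h with ⟨rfl, rfl, rfl, rfl⟩ | ⟨rfl, rfl, rfl, rfl⟩ <;> simp
    · left
      have hbc : b * c = 0 := by rcases h2 with h2 | h2 <;> rw [h2] <;> ring
      have : (a - d) ^ 2 = 0 := by nlinarith
      exact ⟨by nlinarith, hbc.le⟩
    · right
      rcases h with ⟨h, h'⟩ | ⟨h, h'⟩
      · left; exact ⟨h, h'.le⟩
      · right; exact ⟨h, h'.le⟩
  -- The overlap of the three cases of `IsCrooked`: here `a² = 1`, so the matrix is `± 1` or a
  -- parabolic fixing an endpoint.
  · have bdry : ∀ (_ : b * c = 0) (_ : a = d),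
      (((((a + d) ^ 2 < 4 ∧ ∃ y, 0 < y ∧ a = d ∧ b = -c * y ^ 2) ∨
      a = 1 ∧ b = 0 ∧ c = 0 ∧ d = 1 ∨ a = -1 ∧ b = 0 ∧ c = 0 ∧ d = -1) ∨
      (¬(a = 1 ∧ b = 0 ∧ c = 0 ∧ d = 1 ∨ a = -1 ∧ b = 0 ∧ c = 0 ∧ d = -1) ∧ (a + d) ^ 2 = 4) ∧
        (c = 0 ∨ b = 0)) ∨
      4 < (a + d) ^ 2 ∧ (c = 0 ∧ 1 < a ^ 2 ∨ b = 0 ∧ 1 < d ^ 2)) := by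
      rintro h rfl
      left
      by_cases h1 : a = 1 ∧ b = 0 ∧ c = 0 ∧ a = 1 ∨ a = -1 ∧ b = 0 ∧ c = 0 ∧ a = -1
      · exact Or.inl (Or.inr h1)
      · exact Or.inr ⟨⟨h1, by nlinarith⟩, (mul_eq_zero.mp h).symm⟩
    rintro (⟨rfl, h⟩ | ⟨rfl, h⟩ | ⟨rfl, h⟩)
    · rcases h.lt_or_eq with h | h
      · left; left; left
        refine ⟨by nlinarith, √ (-(b / c)), ?_, rfl, ?_⟩
        · have hc : c ≠ 0 := by rintro rfl; simp at h
          rw [Real.sqrt_pos, neg_pos, div_eq_mul_inv, ← div_eq_mul_inv, div_neg_iff]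
          rcases lt_or_gt_of_ne hc with hc | hc
          · left; exact ⟨by nlinarith, hc⟩
          · right; exact ⟨by nlinarith, hc⟩
        · have hc : c ≠ 0 := by rintro rfl; simp at h
          rw [Real.sq_sqrt]
          · field_simp
          · rw [neg_nonneg, ← mul_div_mul_right b c hc]
            exact div_nonpos_of_nonpos_of_nonneg h.le (mul_self_nonneg c)
      · exact bdry h rfl
    · rcases h.lt_or_eq with h | h
      · right
        exact ⟨by nlinarith [sq_pos_of_ne_zero (a := a - d) (by
          intro h'
          obtain rfl : a = d := by linarith
          nlinarith)], Or.inl ⟨rfl, h⟩⟩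
      · refine bdry (by simp) ?_
        linear_combination -d * h - a * hdet
    · rcases h.lt_or_eq with h | h
      · right
        exact ⟨by nlinarith [sq_pos_of_ne_zero (a := a - d) (by
          intro h'
          obtain rfl : a = d := by linarith
          nlinarith)], Or.inr ⟨rfl, h⟩⟩
      · refine bdry (by simp) ?_
        linear_combination a * h + d * hdet

/-! ### Lengthening as growth of matrix entries -/

/-- This is `2 cosh d(i, A i)`, the sum of the squared entries of `A`, for `M` rescaled on both
sides by the diagonal matrices moving `i` to `is` and `it`. No cross terms occur, so the four
squared entries can be isolated. -/
theorem two_mul_cosh_dist_imagPoint (M : SL(2, ℝ)) {s t : ℝ} (hs : 0 < s) (ht : 0 < t) :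
    2 * (s * t) * Real.cosh (dist (imagPoint s hs) (M • imagPoint t ht)) =
      M 0 0 ^ 2 * t ^ 2 + M 0 1 ^ 2 + M 1 0 ^ 2 * (s ^ 2 * t ^ 2) + M 1 1 ^ 2 * s ^ 2 := by
  have hD := SL2.den_pos M (imagPoint t ht)
  have hDe : SL2.den M (imagPoint t ht) = M 1 0 ^ 2 * t ^ 2 + M 1 1 ^ 2 := by
    simp [SL2.den]; ring
  have hdet := SL2.det_eq M
  rw [UpperHalfPlane.cosh_dist, Complex.dist_eq, ← Complex.normSq_eq_norm_sq, Complex.normSq_apply]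
  simp only [Complex.sub_re, Complex.sub_im, UpperHalfPlane.coe_re, UpperHalfPlane.coe_im,
    SL2.re_smul, SL2.im_smul, imagPoint_re, imagPoint_im]
  generalize SL2.den M (imagPoint t ht) = D at hD hDe ⊢
  field_simp
  subst hDe
  linear_combination (-(M 0 0 * M 1 1 - M 0 1 * M 1 0 + 1) * t ^ 2) * hdet

/-- Let `S` and `T` tend to `0`. The other three coefficients follow by inverting `S`, `T` or both.
-/
theorem coeff_nonneg_of_forall_pos {α β γ δ : ℝ}
    (h : ∀ S T : ℝ, 0 < S → 0 < T → 0 ≤ α + β * S + γ * T + δ * (S * T)) : 0 ≤ α := by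
  by_contra! hα
  set m := |β| + |γ| + |δ| + 1 with hm
  have hm0 : 0 < m := by positivity
  set ε := min 1 (-α / (2 * m)) with hε
  have hε0 : 0 < ε := lt_min one_pos (by apply div_pos <;> linarith)
  have hε1 : ε ≤ 1 := min_le_left _ _
  have hε2 : ε * (2 * m) ≤ -α := (le_div_iff₀ (by positivity)).mp (min_le_right _ _)
  have := h ε ε hε0 hε0
  have h1 := mul_le_mul_of_nonneg_right (le_abs_self β) hε0.le
  have h2 := mul_le_mul_of_nonneg_right (le_abs_self γ) hε0.le
  have h3 := mul_le_mul_of_nonneg_right (le_abs_self δ) (mul_pos hε0 hε0).le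
  have h4 : |δ| * (ε * ε) ≤ |δ| * ε :=
    mul_le_mul_of_nonneg_left (by nlinarith) (abs_nonneg δ)
  nlinarith

theorem coeffs_nonneg_of_forall_pos {α β γ δ : ℝ}
    (h : ∀ S T : ℝ, 0 < S → 0 < T → 0 ≤ α + β * S + γ * T + δ * (S * T)) :
    0 ≤ α ∧ 0 ≤ β ∧ 0 ≤ γ ∧ 0 ≤ δ := by
  refine ⟨coeff_nonneg_of_forall_pos h,
    coeff_nonneg_of_forall_pos (α := β) (β := α) (γ := δ) (δ := γ) fun S T hS hT => ?_,
    coeff_nonneg_of_forall_pos (α := γ) (β := δ) (γ := α) (δ := β) fun S T hS hT => ?_,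
    coeff_nonneg_of_forall_pos (α := δ) (β := γ) (γ := β) (δ := α) fun S T hS hT => ?_⟩
  · have := mul_nonneg (h S⁻¹ T (by positivity) hT) hS.le
    field_simp at this ⊢; linarith
  · have := mul_nonneg (h S T⁻¹ hS (by positivity)) hT.le
    field_simp at this ⊢; linarith
  · have := mul_nonneg (h S⁻¹ T⁻¹ (by positivity) (by positivity)) (mul_pos hS hT).le
    field_simp at this ⊢; linarith

theorem Real.cosh_add_le_exp_mul_cosh (x k : ℝ) (hk : 0 ≤ k) :
    Real.cosh (x + k) ≤ Real.exp k * Real.cosh x := by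
  rw [Real.cosh_add, ← Real.cosh_add_sinh k]
  have h1 : 0 ≤ Real.sinh k := Real.sinh_nonneg_iff.mpr hk
  nlinarith [(Real.sinh_lt_cosh x).le]

theorem Real.cosh_mul_cosh_le_cosh_add {x k : ℝ} (hx : 0 ≤ x) (hk : 0 ≤ k) :
    Real.cosh x * Real.cosh k ≤ Real.cosh (x + k) := by
  rw [Real.cosh_add]
  nlinarith [mul_nonneg (Real.sinh_nonneg_iff.mpr hx) (Real.sinh_nonneg_iff.mpr hk)]

/-- The entries of `N` exceed those of `n` in absolute value. -/
def EntriesExceed (N n : SL(2, ℝ)) : Prop := ∀ i j, n i j ^ 2 < N i j ^ 2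

theorem mk_mem_lengtheningSet_iff_dist {G G' N : SL(2, ℝ)} :
    π (G * N * G'⁻¹) ∈ lengtheningSet (π G • imagAxis) (π G' • imagAxis) ↔
      ∃ K : ℝ, 0 < K ∧ ∀ (s t : ℝ) (hs : 0 < s) (ht : 0 < t),
        K ≤ dist (imagPoint s hs) (N • imagPoint t ht) -
          dist (imagPoint s hs) ((G⁻¹ * G') • imagPoint t ht) := by
  refine exists_congr fun K => and_congr_right fun _ => ?_
  have e1 : ∀ w w' : ℍ, dist (π G • w) (π (G * N * G'⁻¹) • (π G' • w')) = dist w (N • w') := by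
    intro w w'
    simp only [psl_mk_smul, mul_smul, inv_smul_smul, dist_smul]
  have e2 : ∀ w w' : ℍ, dist (π G • w) (π G' • w') = dist w ((G⁻¹ * G') • w') := by
    intro w w'
    rw [← dist_smul G w]
    simp only [psl_mk_smul, mul_smul, smul_inv_smul]
  constructor
  · intro h s t hs ht
    rw [← e1, ← e2]
    exact h _ ⟨_, imagPoint_mem s hs, rfl⟩ _ ⟨_, imagPoint_mem t ht, rfl⟩
  · rintro h _ ⟨w, hw, rfl⟩ _ ⟨w', hw', rfl⟩
    have hz : ∀ z ∈ imagAxis, z = imagPoint z.im z.im_pos := fun z hz =>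
      UpperHalfPlane.ext (Complex.ext hz rfl)
    rw [hz w hw, hz w' hw']
    simp only [e1, e2]
    exact h _ _ _ _

/-- A uniform additive gap between distances is a uniform multiplicative gap `κ > 1` between their
cosh, which is a coefficientwise gap between the two polynomials. As there are only four
coefficients, strict inequalities already give such a `κ`. -/
theorem mk_mem_lengtheningSet_iff {G G' N n : SL(2, ℝ)} (hn : G⁻¹ * G' = n)
    (hn0 : ∀ i j, n i j ≠ 0) :
    π (G * N * G'⁻¹) ∈ lengtheningSet (π G • imagAxis) (π G' • imagAxis) ↔ EntriesExceed N n := by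
  rw [mk_mem_lengtheningSet_iff_dist, hn]
  constructor
  · rintro ⟨K, hK, h⟩
    have hκ : 1 < Real.cosh K := Real.one_lt_cosh.mpr hK.ne'
    set κ := Real.cosh K
    -- With `S = s²`, `T = t²`, this is `cosh d · cosh K ≤ cosh (d + K)` multiplied by `2st`.
    have key : ∀ S T : ℝ, 0 < S → 0 < T →
        0 ≤ (N 0 1 ^ 2 - κ * n 0 1 ^ 2) + (N 1 1 ^ 2 - κ * n 1 1 ^ 2) * S +
          (N 0 0 ^ 2 - κ * n 0 0 ^ 2) * T + (N 1 0 ^ 2 - κ * n 1 0 ^ 2) * (S * T) := by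
      intro S T hS hT
      have hs := Real.sqrt_pos.mpr hS
      have ht := Real.sqrt_pos.mpr hT
      have h1 := h (√S) (√T) hs ht
      have h2 := two_mul_cosh_dist_imagPoint N hs ht
      have h3 := two_mul_cosh_dist_imagPoint n hs ht
      rw [Real.sq_sqrt hS.le, Real.sq_sqrt hT.le] at h2 h3
      have h4 := Real.cosh_mul_cosh_le_cosh_add
        (dist_nonneg (x := imagPoint (√S) hs) (y := n • imagPoint (√T) ht)) hK.le
      have h5 : Real.cosh (dist (imagPoint (√S) hs) (n • imagPoint (√T) ht) + K) ≤
          Real.cosh (dist (imagPoint (√S) hs) (N • imagPoint (√T) ht)) := by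
        rw [Real.cosh_le_cosh, abs_of_nonneg (by positivity), abs_of_nonneg dist_nonneg]
        linarith
      have h6 := mul_le_mul_of_nonneg_left (h4.trans h5) (show 0 ≤ 2 * (√S * √T) by positivity)
      rw [← mul_assoc, h2, h3] at h6
      change _ * κ ≤ _ at h6
      linarith
    obtain ⟨h01, h11, h00, h10⟩ := coeffs_nonneg_of_forall_pos key
    intro i j
    have hp : 0 < n i j ^ 2 := by have := hn0 i j; positivity
    fin_cases i <;> fin_cases j <;> simp at hp ⊢ <;> nlinarith
  · intro h
    obtain ⟨κ, hκ, hle⟩ : ∃ κ : ℝ, 1 < κ ∧ ∀ i j, κ * n i j ^ 2 ≤ N i j ^ 2 := by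
      have hp : ∀ i j, 0 < n i j ^ 2 := fun i j => by have := hn0 i j; positivity
      -- The optimal `κ` is the least of the four ratios of squared entries.
      refine ⟨Finset.univ.inf' Finset.univ_nonempty
        fun p : Fin 2 × Fin 2 => N p.1 p.2 ^ 2 / n p.1 p.2 ^ 2, ?_, fun i j => ?_⟩
      · rw [Finset.lt_inf'_iff]
        exact fun p _ => (one_lt_div (hp _ _)).mpr (h _ _)
      · rw [← le_div_iff₀ (hp i j)]
        exact Finset.inf'_le (fun p : Fin 2 × Fin 2 => N p.1 p.2 ^ 2 / n p.1 p.2 ^ 2)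
          (Finset.mem_univ (i, j))
    have hk : 0 < Real.log κ := Real.log_pos hκ
    refine ⟨Real.log κ, hk, fun s t hs ht => ?_⟩
    have h2 := two_mul_cosh_dist_imagPoint N hs ht
    have h3 := two_mul_cosh_dist_imagPoint n hs ht
    have h4 := Real.cosh_add_le_exp_mul_cosh
      (dist (imagPoint s hs) (n • imagPoint t ht)) _ hk.le
    rw [Real.exp_log (by linarith)] at h4
    have h5 : κ * Real.cosh (dist (imagPoint s hs) (n • imagPoint t ht)) ≤
        Real.cosh (dist (imagPoint s hs) (N • imagPoint t ht)) := by
      have hst : 0 < 2 * (s * t) := by positivity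
      refine le_of_mul_le_mul_left ?_ hst
      rw [h2, mul_left_comm, h3]
      nlinarith [mul_le_mul_of_nonneg_right (hle 0 0) (sq_nonneg t), hle 0 1,
        mul_le_mul_of_nonneg_right (hle 1 0) (mul_nonneg (sq_nonneg s) (sq_nonneg t)),
        mul_le_mul_of_nonneg_right (hle 1 1) (sq_nonneg s)]
    have h6 := h4.trans h5
    rw [Real.cosh_le_cosh, abs_of_nonneg (by positivity), abs_of_nonneg dist_nonneg] at h6
    linarith

/-! ### Frames of oriented lines and the away condition -/

theorem OrientedGeodesic.smul_line (h : PSL(2, ℝ)) (L : OrientedGeodesic) :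
    (h • L).line = h • L.line := rfl

theorem OrientedGeodesic.smul_pos (h : PSL(2, ℝ)) (L : OrientedGeodesic) :
    (h • L).pos = h • L.pos := rfl

/-- `G` takes the imaginary axis, with the positive side `0 < re`, to `L`. -/
def OrientedGeodesic.IsImage (L : OrientedGeodesic) (G : SL(2, ℝ)) : Prop :=
  L.line = π G • imagAxis ∧ L.pos = π G • rightHalf

theorem OrientedGeodesic.exists_isImage (L : OrientedGeodesic) : ∃ G, L.IsImage G := by
  obtain ⟨g, h1, h2⟩ := L.exists_smul
  obtain ⟨G, rfl⟩ := QuotientGroup.mk_surjective g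
  exact ⟨G, h1, h2⟩

theorem line_subset_compl_iff {G G' : SL(2, ℝ)} :
    π G' • imagAxis ⊆ (π G • imagAxis ∪ π G • rightHalf)ᶜ ↔
      ∀ y : ℝ, 0 < y → (G⁻¹ * G') 0 0 * (G⁻¹ * G') 1 0 * y ^ 2 +
        (G⁻¹ * G') 0 1 * (G⁻¹ * G') 1 1 < 0 := by
  have key : ∀ z : ℍ, z.re = 0 → (π G' • z ∈ (π G • imagAxis ∪ π G • rightHalf)ᶜ ↔
      (G⁻¹ * G') 0 0 * (G⁻¹ * G') 1 0 * z.im ^ 2 + (G⁻¹ * G') 0 1 * (G⁻¹ * G') 1 1 < 0) := by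
    intro z hz
    have hre : π G • imagAxis ∪ π G • rightHalf = π G • {w : ℍ | 0 ≤ w.re} := by
      rw [← Set.smul_set_union]
      congr 1
      ext w
      simp only [Set.mem_union, mem_imagAxis, mem_rightHalf, Set.mem_ofPred_eq, le_iff_lt_or_eq]
      tauto
    rw [hre, Set.mem_compl_iff, mem_mk_smul_set, psl_mk_smul, ← mul_smul, Set.mem_ofPred_eq, not_le,
      SL2.re_smul, div_neg_iff]
    simp only [hz, (SL2.den_pos (G⁻¹ * G') z).le.not_gt, (SL2.den_pos (G⁻¹ * G') z)]
    simp
  constructor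
  · intro h y hy
    exact (key (imagPoint y hy) rfl).mp (h ⟨_, imagPoint_mem y hy, rfl⟩)
  · rintro h _ ⟨z, hz, rfl⟩
    exact (key z hz).mpr (h z.im z.im_pos)

/-- Seen from `G`, the endpoints of the second line are `n00 / n10` and `n01 / n11`, and both must
be negative. The last two inequalities say the same for `n⁻¹`, with the roles of the lines
exchanged. -/
theorem awayFromEachOther_iff {L M : OrientedGeodesic} {G G' n : SL(2, ℝ)} (hL : L.IsImage G)
    (hM : M.IsImage G') (hn : G⁻¹ * G' = n) (hn0 : ∀ i j, n i j ≠ 0) :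
    AwayFromEachOther L M ↔
      n 0 0 * n 1 0 < 0 ∧ n 0 1 * n 1 1 < 0 ∧ 0 < n 0 0 * n 0 1 ∧ 0 < n 1 0 * n 1 1 := by
  have hn' : G'⁻¹ * G = n⁻¹ := by rw [← hn]; group
  rw [AwayFromEachOther, hL.1, hL.2, hM.1, hM.2, line_subset_compl_iff, line_subset_compl_iff, hn,
    hn']
  obtain ⟨i1, i2, i3, i4⟩ := SL2.inv_apply n
  rw [i1, i2, i3, i4]
  have hpoly : ∀ α β : ℝ, α ≠ 0 → β ≠ 0 →
      ((∀ y : ℝ, 0 < y → α * y ^ 2 + β < 0) ↔ α < 0 ∧ β < 0) := by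
    intro α β hα hβ
    constructor
    · intro h
      constructor
      · refine lt_of_le_of_ne ?_ hα
        by_contra! hp
        have := h (√ ((|β| + 1) / α)) (by positivity)
        rw [Real.sq_sqrt (by positivity), mul_div_cancel₀ _ hα] at this
        linarith [neg_abs_le β]
      · refine lt_of_le_of_ne ?_ hβ
        by_contra! hp
        have := h (√ (β / (|α| + 1))) (by positivity)
        rw [Real.sq_sqrt (by positivity)] at this
        have h2 : -α * (β / (|α| + 1)) < β := by
          rw [mul_div_assoc', div_lt_iff₀ (by positivity)]
          nlinarith [neg_abs_le α]
        linarith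
    · rintro ⟨h1, h2⟩ y hy
      nlinarith [mul_pos_of_neg_of_neg h1 h2, sq_pos_of_pos hy]
  rw [hpoly _ _ (mul_ne_zero (hn0 _ _) (hn0 _ _)) (mul_ne_zero (hn0 _ _) (hn0 _ _)),
    hpoly _ _ (mul_ne_zero (hn0 _ _) (neg_ne_zero.mpr (hn0 _ _)))
      (mul_ne_zero (neg_ne_zero.mpr (hn0 _ _)) (hn0 _ _))]
  constructor
  · rintro ⟨⟨h1, h2⟩, h3, h4⟩
    exact ⟨h1, h2, by linarith, by linarith⟩
  · rintro ⟨h1, h2, h3, h4⟩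
    exact ⟨⟨h1, h2⟩, by linarith, by linarith⟩

/-- A zero entry means that `n` maps one of `0`, `∞` to one of `0`, `∞`, which gives the two lines a
common endpoint. -/
theorem entries_ne_zero_of_disjoint {G G' n : SL(2, ℝ)} (hn : G⁻¹ * G' = n)
    (h : Disjoint (idealClosure (π G • imagAxis)) (idealClosure (π G' • imagAxis))) :
    ∀ i j, n i j ≠ 0 := by
  have key : ∀ v : Fin 2 → ℝ, v ≠ 0 → v 0 * v 1 = 0 →
      (n 0 0 * v 0 + n 0 1 * v 1) * (n 1 0 * v 0 + n 1 1 * v 1) ≠ 0 := by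
    intro v hv h0 h1
    have e1 := (isEndpoint_mulVec_iff (G := G') hv).mpr h0
    have hnv : n.1.mulVec v ≠ 0 := SL2.mulVec_ne_zero n hv
    have e2 := (isEndpoint_mulVec_iff (G := G) hnv).mpr (by simpa using h1)
    have heq : G.1.mulVec (n.1.mulVec v) = G'.1.mulVec v := by
      rw [Matrix.mulVec_mulVec, ← Matrix.SpecialLinearGroup.coe_mul, ← hn, mul_inv_cancel_left]
    simp only [heq] at e2
    exact Set.disjoint_left.mp h e2 e1
  have k1 := key ![1, 0] (by simp) (by simp)
  have k2 := key ![0, 1] (by simp) (by simp)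
  simp at k1 k2
  intro i j
  fin_cases i <;> fin_cases j
  exacts [k1.1, k2.1, k1.2, k2.2]

/-! ### Orthogonal half-circles and the stem quadrant -/

theorem SL2.sq_add_sq_smul (A : SL(2, ℝ)) (z : ℍ) :
    (A • z).re ^ 2 + (A • z).im ^ 2 = (A 0 0 ^ 2 * (z.re ^ 2 + z.im ^ 2) +
      2 * A 0 0 * A 0 1 * z.re + A 0 1 ^ 2) / SL2.den A z := by
  have h : ∀ w : ℍ, w.re ^ 2 + w.im ^ 2 = Complex.normSq (w : ℂ) := fun w => by
    rw [Complex.normSq_apply]; simp [sq]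
  rw [h (A • z), SL2.coe_smul, Complex.normSq_div, ← SL2.den_eq, Complex.normSq_apply]
  congr 1
  simp
  ring

theorem mk_smul_set_eq {A : SL(2, ℝ)} {S T : Set ℍ} (h : ∀ z : ℍ, A • z ∈ T ↔ z ∈ S) :
    π A • S = T := by
  ext z
  rw [mem_mk_smul_set, ← h, smul_inv_smul]

/-- The half-circle of radius `r` centred at the origin. -/
def halfCircle (r : ℝ) : Set ℍ := {z : ℍ | z.re ^ 2 + z.im ^ 2 = r ^ 2}

theorem mem_halfCircle {r : ℝ} {z : ℍ} : z ∈ halfCircle r ↔ z.re ^ 2 + z.im ^ 2 = r ^ 2 := Iff.rfl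

theorem halfCircle_one : {z : ℍ | ‖(z : ℂ)‖ = 1} = halfCircle 1 := by
  ext z
  have h : z.re ^ 2 + z.im ^ 2 = ‖(z : ℂ)‖ ^ 2 := by
    rw [← Complex.normSq_eq_norm_sq, Complex.normSq_apply]; simp [sq]
  rw [mem_halfCircle, h, Set.mem_ofPred_eq, one_pow]
  exact (pow_eq_one_iff_of_nonneg (norm_nonneg _) two_ne_zero).symm

theorem smul_imagAxis_eq_self {P : SL(2, ℝ)} (h : π P • imagAxis = imagAxis) :
    (P 0 1 = 0 ∧ P 1 0 = 0) ∨ (P 0 0 = 0 ∧ P 1 1 = 0) := by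
  have key : ∀ y : ℝ, 0 < y → P 0 0 * P 1 0 * y ^ 2 + P 0 1 * P 1 1 = 0 := by
    intro y hy
    have h1 : P • imagPoint y hy ∈ imagAxis := by
      rw [← h]; exact ⟨_, imagPoint_mem y hy, rfl⟩
    rw [mem_imagAxis, SL2.re_smul, div_eq_zero_iff] at h1
    rcases h1 with h1 | h1
    · simpa using h1
    · exact absurd h1 (SL2.den_pos _ _).ne'
  have h1 := key 1 one_pos
  have h2 := key 2 two_pos
  have hac : P 0 0 * P 1 0 = 0 := by linarith
  have hbd : P 0 1 * P 1 1 = 0 := by linarith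
  have hdet := SL2.det_eq P
  rcases mul_eq_zero.mp hac with h3 | h3 <;> rcases mul_eq_zero.mp hbd with h4 | h4
  · rw [h3, h4] at hdet; simp at hdet
  · exact Or.inr ⟨h3, h4⟩
  · exact Or.inl ⟨h4, h3⟩
  · rw [h3, h4] at hdet; simp at hdet

/-- The isometry in `OrthogonalLines` is determined only up to the stabilizer of the axis. That
stabilizer consists of dilations and their composites with the half-turn, so the orthogonal lines
are the half-circles centred at `0`. -/
theorem exists_smul_halfCircle_eq {P : SL(2, ℝ)} (h : π P • imagAxis = imagAxis) :
    ∃ r : ℝ, 0 < r ∧ π P • halfCircle 1 = halfCircle r := by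
  have hdet := SL2.det_eq P
  rcases smul_imagAxis_eq_self h with ⟨hb, hc⟩ | ⟨ha, hd⟩
  · have ha0 : P 0 0 ≠ 0 := by intro h0; simp [h0, hb] at hdet
    have hd0 : P 1 1 ≠ 0 := by intro h0; simp [h0, hb] at hdet
    have hd : P 1 1 = (P 0 0)⁻¹ := by field_simp; rw [hb] at hdet; linarith
    refine ⟨P 0 0 ^ 2, by positivity, mk_smul_set_eq fun z => ?_⟩
    rw [mem_halfCircle, mem_halfCircle, SL2.sq_add_sq_smul, div_eq_iff (SL2.den_pos _ _).ne',
      SL2.den, hb, hc, hd]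
    simp
    field_simp
  · have hb0 : P 0 1 ≠ 0 := by intro h0; simp [h0, ha] at hdet
    have hc0 : P 1 0 ≠ 0 := by intro h0; simp [h0, ha] at hdet
    have hc : P 1 0 = -(P 0 1)⁻¹ := by field_simp; rw [ha] at hdet; linarith
    refine ⟨P 0 1 ^ 2, by positivity, mk_smul_set_eq fun z => ?_⟩
    rw [mem_halfCircle, mem_halfCircle, SL2.sq_add_sq_smul, div_eq_iff (SL2.den_pos _ _).ne',
      SL2.den, ha, hc, hd]
    simp
    field_simp
    exact eq_comm

theorem isGeodesicLine_smul_halfCircle (k : PSL(2, ℝ)) : IsGeodesicLine (k • halfCircle 1) := by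
  have h2 : √2 * √2 = 2 := Real.mul_self_sqrt (by norm_num)
  -- The quarter turn `z ↦ (z - 1) / (z + 1)` about `i` takes the imaginary axis to the unit
  -- half-circle.
  let R : SL(2, ℝ) := SL2.of (√2 / 2) (-(√2 / 2)) (√2 / 2) (√2 / 2) (by nlinarith)
  refine ⟨k * π R, ?_⟩
  rw [mul_smul]
  congr 1
  refine (mk_smul_set_eq fun z => ?_).symm
  rw [mem_halfCircle, SL2.sq_add_sq_smul, div_eq_iff (SL2.den_pos _ _).ne', SL2.den,
    Set.mem_ofPred_eq]
  simp only [R, SL2.of_00, SL2.of_01, SL2.of_10, SL2.of_11]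
  have h3 : (√2 / 2) ^ 2 = 1 / 2 := by nlinarith
  constructor
  · intro h
    nlinarith
  · intro h
    rw [h]; ring

theorem entries_of_preserves_halfCircle {X : SL(2, ℝ)} {r : ℝ} (hr : 0 < r)
    (hX : 4 < (X 0 0 + X 1 1) ^ 2) (h : ∀ z ∈ halfCircle r, X • z ∈ halfCircle r) :
    X 0 0 = X 1 1 ∧ X 0 1 = X 1 0 * r ^ 2 := by
  have key : ∀ x y : ℝ, 0 < y → x ^ 2 + y ^ 2 = r ^ 2 →
      X 0 0 ^ 2 * r ^ 2 + 2 * X 0 0 * X 0 1 * x + X 0 1 ^ 2 =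
        r ^ 2 * (X 1 0 ^ 2 * r ^ 2 + 2 * X 1 0 * X 1 1 * x + X 1 1 ^ 2) := by
    intro x y hy hxy
    have h1 := h ⟨⟨x, y⟩, hy⟩ hxy
    rw [mem_halfCircle, SL2.sq_add_sq_smul, div_eq_iff (SL2.den_pos _ _).ne', SL2.den] at h1
    change X 0 0 ^ 2 * (x ^ 2 + y ^ 2) + 2 * X 0 0 * X 0 1 * x + X 0 1 ^ 2 =
      r ^ 2 * ((X 1 0 * x + X 1 1) ^ 2 + (X 1 0 * y) ^ 2) at h1
    rw [hxy] at h1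
    rw [h1]
    linear_combination r ^ 2 * X 1 0 ^ 2 * hxy
  have k0 := key 0 r hr (by ring)
  -- The invariance equation is affine in `x`, so two points suffice: the top of the circle and a
  -- rational one.
  have k1 := key (3 / 5 * r) (4 / 5 * r) (by positivity) (by ring)
  have hdet := SL2.det_eq X
  generalize X 0 0 = a at *
  generalize X 0 1 = b at *
  generalize X 1 0 = c at *
  generalize X 1 1 = d at *
  have hab : a * b = r ^ 2 * (c * d) := by
    have : r * (a * b) = r * (r ^ 2 * (c * d)) := by linarith
    exact mul_left_cancel₀ hr.ne' this
  have e1 : (a * r + b) ^ 2 = (r * (c * r + d)) ^ 2 := by linear_combination k0 + 2 * r * hab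
  have e2 : (a * r - b) ^ 2 = (r * (c * r - d)) ^ 2 := by linear_combination k0 - 2 * r * hab
  -- The equations say that `X` maps each of `r`, `-r` into `{r, -r}`. Sending both to the same
  -- point would force the determinant to vanish, and exchanging them would force the trace to
  -- vanish, against hyperbolicity; hence both are fixed.
  rcases sq_eq_sq_iff_eq_or_eq_neg.mp e1 with f1 | f1 <;>
    rcases sq_eq_sq_iff_eq_or_eq_neg.mp e2 with f2 | f2
  · have ha : a = c * r := mul_left_cancel₀ hr.ne' (by linarith)
    have hb : b = r * d := by linarith
    rw [ha, hb] at hdet; ring_nf at hdet; norm_num at hdet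
  · exact ⟨mul_left_cancel₀ hr.ne' (by linarith), by linarith⟩
  · have ha : a = -d := mul_left_cancel₀ hr.ne' (by linarith)
    rw [ha] at hX; norm_num at hX
  · have ha : a = -(c * r) := mul_left_cancel₀ hr.ne' (by linarith)
    have hb : b = -(r * d) := by linarith
    rw [ha, hb] at hdet; ring_nf at hdet; norm_num at hdet

/-- The matrices of the elements of the stem quadrant of the imaginary axis. -/
def IsStem (X : SL(2, ℝ)) : Prop := X 0 0 = X 1 1 ∧ 0 < X 0 0 * X 0 1 ∧ 0 < X 0 0 * X 1 0

theorem IsStem.mul_pos {X : SL(2, ℝ)} (h : IsStem X) : 0 < X 0 1 * X 1 0 := by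
  have h1 := _root_.mul_pos h.2.1 h.2.2
  have h2 : X 0 0 * X 0 1 * (X 0 0 * X 1 0) = X 0 0 ^ 2 * (X 0 1 * X 1 0) := by ring
  rw [h2] at h1
  by_contra! hle
  exact absurd (mul_nonpos_of_nonneg_of_nonpos (sq_nonneg (X 0 0)) hle) h1.not_ge

/-- The fixed points of `X` are `r` and `-r` exactly when its diagonal entries agree and `X01 = X10
r²`. The direction of translation is then read off from the sign of `re (X • ir)`, that is of `X00
X10`. -/
theorem mk_conj_mem_stemQuadrant_iff {L : OrientedGeodesic} {G X : SL(2, ℝ)} (hL : L.IsImage G) :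
    π (G * X * G⁻¹) ∈ stemQuadrant L ↔ IsStem X := by
  have hact : ∀ z : ℍ, π (G * X * G⁻¹) • π G • z = π G • X • z := by
    intro z
    simp only [psl_mk_smul, mul_smul, inv_smul_smul]
  have hdet := SL2.det_eq X
  simp only [stemQuadrant, Set.mem_ofPred_eq, PSLHyperbolic_mk, SL2.trace_conj, hL.1, hL.2]
  constructor
  · rintro ⟨hX, m, ⟨-, hm⟩, ⟨k, hk1, hk2⟩, hpos⟩
    obtain ⟨K, rfl⟩ := QuotientGroup.mk_surjective k
    have hP : π (G⁻¹ * K) • imagAxis = imagAxis := by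
      rw [show π (G⁻¹ * K) = (π G)⁻¹ * π K from rfl, mul_smul, inv_smul_eq_iff]
      exact hk2.symm
    obtain ⟨r, hr, hC⟩ := exists_smul_halfCircle_eq hP
    have hmC : m = π G • halfCircle r := by
      rw [hk1, halfCircle_one, ← hC, show π (G⁻¹ * K) = (π G)⁻¹ * π K from rfl, mul_smul,
        smul_inv_smul]
    have hpres : ∀ z ∈ halfCircle r, X • z ∈ halfCircle r := by
      intro z hz
      have h1 : π (G * X * G⁻¹) • π G • z ∈ m := by
        rw [← hm]
        refine Set.smul_mem_smul_set ?_
        rw [hmC]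
        exact Set.smul_mem_smul_set hz
      rw [hact, hmC] at h1
      exact Set.smul_mem_smul_set_iff.mp h1
    obtain ⟨had, hbc⟩ := entries_of_preserves_halfCircle hr hX hpres
    have hp := hpos (π G • imagPoint r hr) ⟨by
      rw [hmC]
      refine Set.smul_mem_smul_set ?_
      simp [mem_halfCircle], Set.smul_mem_smul_set (imagPoint_mem r hr)⟩
    rw [hact, Set.smul_mem_smul_set_iff, mem_rightHalf, SL2.re_smul] at hp
    have hp' := (div_pos_iff_of_pos_right (SL2.den_pos _ _)).mp hp
    simp only [imagPoint_re, imagPoint_im] at hp'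
    have hr2 : 0 < r ^ 2 := by positivity
    have : 0 < X 0 0 * X 1 0 := by
      have : 0 < (X 0 0 * X 1 0) * (2 * r ^ 2) := by
        rw [hbc, ← had] at hp'
        linarith
      exact (mul_pos_iff_of_pos_right (by positivity)).mp this
    exact ⟨had, by rw [hbc, ← mul_assoc]; positivity, this⟩
  · intro hX
    obtain ⟨had, hb, hc⟩ := hX
    have hbc : 0 < X 0 1 * X 1 0 := IsStem.mul_pos ⟨had, hb, hc⟩
    have hq : 0 < X 0 1 / X 1 0 := by
      rcases pos_and_pos_or_neg_and_neg_of_mul_pos hbc with ⟨h1, h2⟩ | ⟨h1, h2⟩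
      · exact div_pos h1 h2
      · exact div_pos_of_neg_of_neg h1 h2
    have hc0 : X 1 0 ≠ 0 := right_ne_zero_of_mul hbc.ne'
    set r := √ (X 0 1 / X 1 0) with hr
    have hr0 : 0 < r := Real.sqrt_pos.mpr hq
    have hr2 : X 0 1 = X 1 0 * r ^ 2 := by
      rw [hr, Real.sq_sqrt hq.le]; field_simp
    have hs := Real.sqrt_pos.mpr hr0
    -- The dilation by `r`, so that `G * P` carries the standard orthogonal pair to the axis and the
    -- line.
    let P : SL(2, ℝ) := SL2.of (√r) 0 0 (√r)⁻¹ (by simp [hs.ne'])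
    have hPI : π P • imagAxis = imagAxis := by
      refine mk_smul_set_eq fun z => ?_
      rw [mem_imagAxis, mem_imagAxis, SL2.re_smul, div_eq_iff (SL2.den_pos _ _).ne']
      simp [P, hs.ne']
    have hPC : π P • halfCircle 1 = halfCircle r := by
      refine mk_smul_set_eq fun z => ?_
      rw [mem_halfCircle, mem_halfCircle, SL2.sq_add_sq_smul, div_eq_iff (SL2.den_pos _ _).ne',
        SL2.den]
      simp [P, Real.sq_sqrt hr0.le]
      field_simp
    have hmG : π G • halfCircle r = π (G * P) • halfCircle 1 := by
      rw [← hPC]; exact (mul_smul (π G) (π P) _).symm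
    refine ⟨by nlinarith, π G • halfCircle r, ⟨?_, ?_⟩, ⟨π (G * P), ?_, ?_⟩, ?_⟩
    · rw [hmG]; exact isGeodesicLine_smul_halfCircle _
    · have hXC : π X • halfCircle r = halfCircle r := by
        refine mk_smul_set_eq fun z => ?_
        have hD := SL2.den_pos X z
        rw [mem_halfCircle, mem_halfCircle, SL2.sq_add_sq_smul, div_eq_iff hD.ne', SL2.den, hr2,
          ← had]
        rw [← had, hr2] at hdet
        have e : X 0 0 ^ 2 * (z.re ^ 2 + z.im ^ 2) + 2 * X 0 0 * (X 1 0 * r ^ 2) * z.re +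
            (X 1 0 * r ^ 2) ^ 2 - r ^ 2 * ((X 1 0 * z.re + X 0 0) ^ 2 + (X 1 0 * z.im) ^ 2) =
            z.re ^ 2 + z.im ^ 2 - r ^ 2 := by
          linear_combination (z.re ^ 2 + z.im ^ 2 - r ^ 2) * hdet
        rw [← sub_eq_zero, e, sub_eq_zero]
      rw [← PSL.mk_conj_mk, mul_smul, inv_smul_smul, mul_smul, hXC]
    · rw [halfCircle_one, hmG]
    · change _ = π (G * P) • imagAxis
      nth_rewrite 1 [← hPI]
      exact (mul_smul (π G) (π P) _).symm
    · rintro _ ⟨⟨z, hz, rfl⟩, hz2⟩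
      have hz3 : z ∈ imagAxis := Set.smul_mem_smul_set_iff.mp hz2
      rw [mem_imagAxis] at hz3
      rw [mem_halfCircle, hz3] at hz
      change π (G * X * G⁻¹) • π G • z ∈ _
      rw [hact]
      refine Set.smul_mem_smul_set ?_
      rw [mem_rightHalf, SL2.re_smul]
      refine div_pos ?_ (SL2.den_pos _ _)
      rw [hz3, hz, ← had]
      nlinarith [mul_pos hc (sq_pos_of_pos hr0)]

theorem PSL.exists_conj (G : SL(2, ℝ)) (h : PSL(2, ℝ)) : ∃ X, h = π (G * X * G⁻¹) := by
  obtain ⟨A, rfl⟩ := QuotientGroup.mk_surjective h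
  exact ⟨G⁻¹ * A * G, by group⟩

/-! ### Continuous functions on PSL(2, ℝ) and the boundary of the stem quadrant -/

theorem PSL.continuous_mk : Continuous π := QuotientGroup.continuous_mk

theorem SL2.continuous_apply (i j : Fin 2) : Continuous fun A : SL(2, ℝ) => A i j :=
  (continuous_subtype_val (p := fun A : Matrix (Fin 2) (Fin 2) ℝ => A.det = 1)).matrix_elem i j

theorem SL2.continuous_of {Y : Type*} [TopologicalSpace Y] {a b c d : Y → ℝ} (ha : Continuous a)
    (hb : Continuous b) (hc : Continuous c) (hd : Continuous d)
    (h : ∀ y, a y * d y - b y * c y = 1) :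
    Continuous fun y => SL2.of (a y) (b y) (c y) (d y) (h y) := by
  refine Continuous.subtype_mk (continuous_matrix fun i j => ?_) _
  fin_cases i <;> fin_cases j <;> assumption

/-- The product of two entries of a lift of an element of `PSL(2, ℝ)`. -/
def PSL.entryMul (i j k l : Fin 2) (h : PSL(2, ℝ)) : ℝ := h.out i j * h.out k l

/-- A product of two entries is unchanged by the sign of the lift, so it descends to a continuous
function on the quotient. -/
theorem PSL.entryMul_mk (i j k l : Fin 2) (A : SL(2, ℝ)) :
    PSL.entryMul i j k l (π A) = A i j * A k l := by
  rw [PSL.entryMul]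
  rcases PSL.mk_eq_mk_iff.mp (QuotientGroup.out_eq' (π A)) with h | h <;> rw [h]
  simp

theorem PSL.continuous_entryMul (i j k l : Fin 2) : Continuous (PSL.entryMul i j k l) := by
  rw [QuotientGroup.isOpenQuotientMap_mk.isQuotientMap.continuous_iff]
  have : PSL.entryMul i j k l ∘ π = fun A => A i j * A k l :=
    funext fun A => PSL.entryMul_mk i j k l A
  rw [this]
  exact (SL2.continuous_apply i j).mul (SL2.continuous_apply k l)

/-- The product of two entries of the matrix of `h` relative to the frames `G`, `G'`. -/
def PSL.frameMul (G G' : SL(2, ℝ)) (i j k l : Fin 2) (h : PSL(2, ℝ)) : ℝ :=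
  PSL.entryMul i j k l ((π G)⁻¹ * h * π G')

theorem PSL.frameMul_mk (G G' N : SL(2, ℝ)) (i j k l : Fin 2) :
    PSL.frameMul G G' i j k l (π (G * N * G'⁻¹)) = N i j * N k l := by
  have : (π G)⁻¹ * π (G * N * G'⁻¹) * π G' = π (G⁻¹ * (G * N * G'⁻¹) * G') := rfl
  rw [PSL.frameMul, this, PSL.entryMul_mk]
  congr <;> group

theorem PSL.continuous_frameMul (G G' : SL(2, ℝ)) (i j k l : Fin 2) :
    Continuous (PSL.frameMul G G' i j k l) :=
  (PSL.continuous_entryMul i j k l).comp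
    ((continuous_const.mul continuous_id).mul continuous_const)

/-- The plane is the hyperplane of matrices with equal diagonal entries in the frame `G`: stem
matrices satisfy this linear equation, and three explicit ones span its solutions. -/
theorem mk_conj_mem_projSpan_iff {L : OrientedGeodesic} {G X : SL(2, ℝ)} (hL : L.IsImage G) :
    π (G * X * G⁻¹) ∈ projSpan (stemQuadrant L) ↔ X 0 0 = X 1 1 := by
  constructor
  · rintro ⟨A, hA, hspan⟩
    have hle : Submodule.span ℝ {M : Matrix (Fin 2) (Fin 2) ℝ |
        ∃ B : SL(2, ℝ), π B ∈ stemQuadrant L ∧ B.1 = M} ≤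
        LinearMap.ker ((Matrix.entryLinearMap ℝ ℝ (0 : Fin 2) (0 : Fin 2) -
          Matrix.entryLinearMap ℝ ℝ (1 : Fin 2) (1 : Fin 2)) ∘ₗ
          LinearMap.mulLeft ℝ (G⁻¹).1 ∘ₗ LinearMap.mulRight ℝ G.1) := by
      rw [Submodule.span_le]
      rintro _ ⟨B, hB, rfl⟩
      have hB2 : B = G * (G⁻¹ * B * G) * G⁻¹ := by group
      rw [hB2, mk_conj_mem_stemQuadrant_iff hL] at hB
      have := hB.1
      rw [mul_assoc] at this
      simp only [SetLike.mem_coe, LinearMap.mem_ker, LinearMap.comp_apply, LinearMap.sub_apply,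
        LinearMap.mulLeft_apply, LinearMap.mulRight_apply, Matrix.entryLinearMap_apply]
      exact sub_eq_zero.mpr this
    have h1 := hle hspan
    simp only [LinearMap.mem_ker, LinearMap.comp_apply, LinearMap.sub_apply,
      LinearMap.mulLeft_apply, LinearMap.mulRight_apply, Matrix.entryLinearMap_apply] at h1
    have h2 : (G⁻¹ * (A * G)) 0 0 = (G⁻¹ * (A * G)) 1 1 := sub_eq_zero.mp h1
    rcases PSL.mk_eq_mk_iff.mp hA with rfl | rfl
    · have : G⁻¹ * (G * X * G⁻¹ * G) = X := by group
      rwa [this] at h2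
    · have : G⁻¹ * (-(G * X * G⁻¹) * G) = -X := by rw [neg_mul, mul_neg]; congr 1; group
      rw [this] at h2
      simpa using h2
  · intro hX
    refine ⟨_, rfl, ?_⟩
    have hmem : ∀ (B : SL(2, ℝ)) (M : Matrix (Fin 2) (Fin 2) ℝ), IsStem B → B.1 = M →
        G.1 * M * (G⁻¹).1 ∈ Submodule.span ℝ {M : Matrix (Fin 2) (Fin 2) ℝ |
        ∃ B : SL(2, ℝ), π B ∈ stemQuadrant L ∧ B.1 = M} := by
      rintro B _ hB rfl
      exact Submodule.subset_span ⟨G * B * G⁻¹, (mk_conj_mem_stemQuadrant_iff hL).mpr hB, rfl⟩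
    have m1 := hmem (SL2.of (5 / 4) (3 / 4) (3 / 4) (5 / 4) (by norm_num)) _
      (by refine ⟨rfl, ?_, ?_⟩ <;> simp) rfl
    have m2 := hmem (SL2.of (5 / 4) (3 / 2) (3 / 8) (5 / 4) (by norm_num)) _
      (by refine ⟨rfl, ?_, ?_⟩ <;> simp) rfl
    have m3 := hmem (SL2.of (5 / 3) (4 / 3) (4 / 3) (5 / 3) (by norm_num)) _
      (by refine ⟨rfl, ?_, ?_⟩ <;> simp) rfl
    have hcomb : X.1 =
        (16 / 5 * X 0 0 - 20 / 9 * X 0 1 - 16 / 9 * X 1 0) • !![5 / 4, 3 / 4; 3 / 4, 5 / 4] +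
        (8 / 9 * X 0 1 - 8 / 9 * X 1 0) • !![5 / 4, 3 / 2; 3 / 8, 5 / 4] +
        (-(9 / 5) * X 0 0 + X 0 1 + 2 * X 1 0) • !![5 / 3, 4 / 3; 4 / 3, 5 / 3] := by
      ext i j
      fin_cases i <;> fin_cases j <;> simp <;> linarith
    have hcalc : (G * X * G⁻¹).1 = G.1 * X.1 * (G⁻¹).1 := rfl
    rw [hcalc, hcomb]
    simp only [Matrix.mul_add, Matrix.add_mul, Matrix.mul_smul, Matrix.smul_mul]
    exact Submodule.add_mem _ (Submodule.add_mem _ (Submodule.smul_mem _ _ m1)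
      (Submodule.smul_mem _ _ m2)) (Submodule.smul_mem _ _ m3)

/-- The matrices of the elements of the boundary of the stem quadrant of the imaginary axis. -/
def IsStemBoundary (X : SL(2, ℝ)) : Prop :=
  X 0 0 = X 1 1 ∧ 0 ≤ X 0 0 * X 0 1 ∧ 0 ≤ X 0 0 * X 1 0 ∧ X 0 1 * X 1 0 = 0

theorem mul_abs_eq_self {a x : ℝ} (ha : a ^ 2 = 1) (hx : 0 ≤ a * x) : a * |x| = x := by
  rcases mul_self_eq_one_iff.mp (by rwa [sq] at ha) with rfl | rfl
  · rw [abs_of_nonneg (by linarith)]; ring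
  · rw [abs_of_nonpos (by linarith)]; ring

theorem mk_conj_mem_closure_stemQuadrant {L : OrientedGeodesic} {G X : SL(2, ℝ)}
    (hL : L.IsImage G) (hX : IsStemBoundary X) : π (G * X * G⁻¹) ∈ closure (stemQuadrant L) := by
  obtain ⟨had, hb, hc, hbc⟩ := hX
  have hdet := SL2.det_eq X
  have ha2 : X 0 0 ^ 2 = 1 := by rw [hbc, ← had] at hdet; linarith
  -- Both off-diagonal entries are enlarged in absolute value by `|ε|`, the diagonal being
  -- readjusted to keep determinant 1. The factor `X 0 0 = ± 1` carries the common sign, and `ε ≠ 0`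
  -- gives a stem matrix.
  let f : ℝ → ℝ := fun ε => √ (1 + (|X 0 1| + |ε|) * (|X 1 0| + |ε|))
  have hf : ∀ ε, f ε ^ 2 = 1 + (|X 0 1| + |ε|) * (|X 1 0| + |ε|) := fun ε =>
    Real.sq_sqrt (by positivity)
  have hf0 : ∀ ε, 0 < f ε := fun ε => Real.sqrt_pos.mpr (by positivity)
  let Z : ℝ → SL(2, ℝ) := fun ε => SL2.of (X 0 0 * f ε) (X 0 0 * (|X 0 1| + |ε|))
    (X 0 0 * (|X 1 0| + |ε|)) (X 0 0 * f ε) (by linear_combination (X 0 0) ^ 2 * hf ε + ha2)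
  have hZ : Continuous Z := by
    apply SL2.continuous_of <;> fun_prop
  have hZ0 : Z 0 = X := by
    have e : f 0 = 1 := by simp [f, ← abs_mul, hbc]
    rw [SL2.ext_iff]
    refine ⟨?_, ?_, ?_, ?_⟩
    · change X 0 0 * f 0 = _
      rw [e, mul_one]
    · change X 0 0 * (|X 0 1| + |0|) = _
      rw [abs_zero, add_zero, mul_abs_eq_self ha2 hb]
    · change X 0 0 * (|X 1 0| + |0|) = _
      rw [abs_zero, add_zero, mul_abs_eq_self ha2 hc]
    · change X 0 0 * f 0 = _
      rw [e, mul_one, had]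
  have hmaps : Set.MapsTo (fun ε => π (G * Z ε * G⁻¹)) {0}ᶜ (stemQuadrant L) := by
    intro ε hε
    have hε' : 0 < |ε| := abs_pos.mpr hε
    rw [mk_conj_mem_stemQuadrant_iff hL]
    have k := hf0 ε
    have h2 : 0 < X 0 0 ^ 2 := by rw [ha2]; norm_num
    refine ⟨rfl, ?_, ?_⟩
    · change 0 < X 0 0 * f ε * (X 0 0 * (|X 0 1| + |ε|))
      rw [show X 0 0 * f ε * (X 0 0 * (|X 0 1| + |ε|)) = X 0 0 ^ 2 * (f ε * (|X 0 1| + |ε|)) by ring]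
      positivity
    · change 0 < X 0 0 * f ε * (X 0 0 * (|X 1 0| + |ε|))
      rw [show X 0 0 * f ε * (X 0 0 * (|X 1 0| + |ε|)) = X 0 0 ^ 2 * (f ε * (|X 1 0| + |ε|)) by ring]
      positivity
  have hcont : Continuous fun ε => π (G * Z ε * G⁻¹) :=
    PSL.continuous_mk.comp ((continuous_const.mul hZ).mul continuous_const)
  have h0 : (0 : ℝ) ∈ closure ({0}ᶜ : Set ℝ) := by
    rw [(dense_compl_singleton (0 : ℝ)).closure_eq]; trivial
  have := map_mem_closure hcont h0 hmaps
  simpa only [hZ0] using this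

/-- The quadrant is relatively open in its plane, so its frontier there is its closure minus itself.
-/
theorem mk_conj_mem_stemQuadrantBoundary_iff {L : OrientedGeodesic} {G X : SL(2, ℝ)}
    (hL : L.IsImage G) : π (G * X * G⁻¹) ∈ stemQuadrantBoundary L ↔ IsStemBoundary X := by
  set S := stemQuadrant L with hS
  have hsub : S ⊆ projSpan S := by
    intro h hh
    obtain ⟨X, rfl⟩ := PSL.exists_conj G h
    exact (mk_conj_mem_projSpan_iff hL).mpr ((mk_conj_mem_stemQuadrant_iff hL).mp hh).1
  let O : Set PSL(2, ℝ) := {h | 0 < PSL.frameMul G G 0 0 0 1 h ∧ 0 < PSL.frameMul G G 0 0 1 0 h}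
  have hO : IsOpen O :=
    (isOpen_lt continuous_const (PSL.continuous_frameMul G G 0 0 0 1)).inter
      (isOpen_lt continuous_const (PSL.continuous_frameMul G G 0 0 1 0))
  have hSO : (Subtype.val ⁻¹' S : Set (projSpan S)) = Subtype.val ⁻¹' O := by
    ext ⟨h, hh⟩
    obtain ⟨Y, rfl⟩ := PSL.exists_conj G h
    rw [mk_conj_mem_projSpan_iff hL] at hh
    simp only [Set.mem_preimage, O, Set.mem_ofPred_eq, PSL.frameMul_mk, hS,
      mk_conj_mem_stemQuadrant_iff hL, IsStem, hh, true_and]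
  have hopen : IsOpen (Subtype.val ⁻¹' S : Set (projSpan S)) := by
    rw [hSO]; exact hO.preimage continuous_subtype_val
  have hmem : π (G * X * G⁻¹) ∈ stemQuadrantBoundary L ↔
      π (G * X * G⁻¹) ∈ projSpan S ∧ π (G * X * G⁻¹) ∈ closure S ∧ π (G * X * G⁻¹) ∉ S := by
    rw [stemQuadrantBoundary, ← hS, hopen.frontier_eq,
      Topology.IsInducing.subtypeVal.closure_eq_preimage_closure_image,
      Subtype.image_preimage_coe, Set.inter_eq_right.mpr hsub]
    constructor
    · rintro ⟨⟨h, hh⟩, ⟨h1, h2⟩, rfl⟩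
      exact ⟨hh, h1, h2⟩
    · rintro ⟨h1, h2, h3⟩
      exact ⟨⟨_, h1⟩, ⟨h2, h3⟩, rfl⟩
  rw [hmem, mk_conj_mem_projSpan_iff hL, mk_conj_mem_stemQuadrant_iff hL]
  have hdet := SL2.det_eq X
  constructor
  · rintro ⟨had, hcl, hns⟩
    -- The third inequality, `1 ≤ X00²`, keeps `X00` away from `0`, where the first two would carry
    -- no information.
    let C : Set PSL(2, ℝ) := {h | 0 ≤ PSL.frameMul G G 0 0 0 1 h} ∩
      ({h | 0 ≤ PSL.frameMul G G 0 0 1 0 h} ∩ {h | 1 ≤ PSL.frameMul G G 0 0 0 0 h})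
    have hC : IsClosed C :=
      (isClosed_le continuous_const (PSL.continuous_frameMul G G 0 0 0 1)).inter
        ((isClosed_le continuous_const (PSL.continuous_frameMul G G 0 0 1 0)).inter
          (isClosed_le continuous_const (PSL.continuous_frameMul G G 0 0 0 0)))
    have hSC : S ⊆ C := by
      intro h hh
      obtain ⟨Y, rfl⟩ := PSL.exists_conj G h
      rw [hS, mk_conj_mem_stemQuadrant_iff hL] at hh
      have hd := SL2.det_eq Y
      have hp := hh.mul_pos
      simp only [C, Set.mem_inter_iff, Set.mem_ofPred_eq, PSL.frameMul_mk]
      refine ⟨hh.2.1.le, hh.2.2.le, ?_⟩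
      nth_rewrite 2 [hh.1]
      linarith
    have h1 := closure_minimal hSC hC hcl
    simp only [C, Set.mem_inter_iff, Set.mem_ofPred_eq, PSL.frameMul_mk] at h1
    obtain ⟨hb, hc, ha⟩ := h1
    refine ⟨had, hb, hc, ?_⟩
    have ha0 : X 0 0 ≠ 0 := by rintro h0; rw [h0] at ha; norm_num at ha
    by_contra hne
    apply hns
    refine ⟨had, lt_of_le_of_ne hb (mul_ne_zero ha0 (left_ne_zero_of_mul hne)).symm,
      lt_of_le_of_ne hc (mul_ne_zero ha0 (right_ne_zero_of_mul hne)).symm⟩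
  · intro hX
    refine ⟨hX.1, mk_conj_mem_closure_stemQuadrant hL hX, fun h => ?_⟩
    exact h.mul_pos.ne' hX.2.2.2

/-! ### Disjointness of crooked planes -/

theorem IsCrooked.neg {X : SL(2, ℝ)} (h : IsCrooked X) : IsCrooked (-X) := by
  simpa [IsCrooked] using h

/-- An element of the crooked plane of the imaginary axis contracts a nonzero diagonal form. -/
theorem IsCrooked.exists_form {X : SL(2, ℝ)} (h : IsCrooked X) :
    ∃ s₀ s₁ r : ℝ, 0 ≤ s₀ ∧ 0 ≤ s₁ ∧ 0 < s₀ + s₁ ∧ 0 ≤ r ∧ r ≤ 1 ∧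
      X 0 0 ^ 2 * s₀ + X 1 0 ^ 2 * s₁ = r * s₀ ∧
      X 0 0 * X 0 1 * s₀ + X 1 0 * X 1 1 * s₁ = 0 ∧
      X 0 1 ^ 2 * s₀ + X 1 1 ^ 2 * s₁ = r * s₁ := by
  have hdet := SL2.det_eq X
  rcases h with ⟨had, hbc⟩ | ⟨hc, ha⟩ | ⟨hb, hd⟩
  · rw [← had] at hdet ⊢
    by_cases h0 : X 0 1 = 0 ∧ X 1 0 = 0
    · rw [h0.1, h0.2] at hdet ⊢
      refine ⟨1, 1, 1, by norm_num, by norm_num, by norm_num, by norm_num, le_rfl, ?_, ?_, ?_⟩ <;>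
        linarith
    · have hm : |X 0 1| * |X 1 0| = -(X 0 1 * X 1 0) := by rw [← abs_mul, abs_of_nonpos hbc]
      have hcross : X 0 1 * |X 1 0| + X 1 0 * |X 0 1| = 0 := by
        rcases le_total 0 (X 0 1) with h1 | h1 <;> rcases le_total 0 (X 1 0) with h2 | h2 <;>
          simp only [abs_of_nonneg, abs_of_nonpos, h1, h2] at hm ⊢ <;> nlinarith
      have e1 := sq_abs (X 0 1)
      have e2 := sq_abs (X 1 0)
      -- With equal diagonal entries and `X01 X10 ≤ 0`, the form `|X10| x² + |X01| y²` is invariant.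
      refine ⟨|X 1 0|, |X 0 1|, 1, abs_nonneg _, abs_nonneg _, ?_, zero_le_one, le_rfl, ?_, ?_, ?_⟩
      · by_contra! hle
        apply h0
        constructor <;> rw [← abs_eq_zero] <;> linarith [abs_nonneg (X 0 1), abs_nonneg (X 1 0)]
      · linear_combination |X 1 0| * hdet - |X 0 1| * e2 + |X 1 0| * hm
      · linear_combination X 0 0 * hcross
      · linear_combination |X 0 1| * hdet - |X 1 0| * e1 + |X 0 1| * hm
  · rw [hc] at hdet ⊢
    -- In the triangular case the form degenerates to the square of one coordinate, scaled by the
    -- square of the contracting eigenvalue.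
    refine ⟨0, 1, X 1 1 ^ 2, le_rfl, zero_le_one, by norm_num, sq_nonneg _, ?_, by ring, by ring,
      by ring⟩
    have : X 0 0 ^ 2 * X 1 1 ^ 2 = 1 := by linear_combination (X 0 0 * X 1 1 + 1) * hdet
    nlinarith [sq_nonneg (X 1 1)]
  · rw [hb] at hdet ⊢
    refine ⟨1, 0, X 0 0 ^ 2, zero_le_one, le_rfl, by norm_num, sq_nonneg _, ?_, by ring, by ring,
      by ring⟩
    have : X 0 0 ^ 2 * X 1 1 ^ 2 = 1 := by linear_combination (X 0 0 * X 1 1 + 1) * hdet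
    nlinarith [sq_nonneg (X 0 0)]

/-- The forms contracted by `X` and `Y` weight the rows and columns. The resulting sum `∑ sᵢ tⱼ
Nᵢⱼ²` equals `q r` times the same sum for `n`, with `q r ≤ 1`, while some weight is positive. -/
theorem not_entriesExceed_of_isCrooked {X Y N n : SL(2, ℝ)} (hX : IsCrooked X) (hY : IsCrooked Y)
    (h : X * n = N * Y) : ¬ EntriesExceed N n := by
  intro hN
  obtain ⟨s₀, s₁, r, hs0, hs1, hs, hr0, hr1, x1, x2, x3⟩ := hX.exists_form
  -- The names are swapped because `Y` acts on rows from the right, through the adjugate form.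
  obtain ⟨t₁, t₀, q, ht1, ht0, ht, hq0, hq1, y1, y2, y3⟩ := hY.exists_form
  obtain ⟨e00, e01, e10, e11⟩ := SL2.ext_iff.mp h
  simp only [SL2.mul_apply] at e00 e01 e10 e11
  have hdet := SL2.det_eq Y
  set w00 := X 0 0 * n 0 0 + X 0 1 * n 1 0 with hw00
  set w01 := X 0 0 * n 0 1 + X 0 1 * n 1 1 with hw01
  set w10 := X 1 0 * n 0 0 + X 1 1 * n 1 0 with hw10
  set w11 := X 1 0 * n 0 1 + X 1 1 * n 1 1 with hw11
  have row : ∀ a b u v : ℝ, u = a * Y 0 0 + b * Y 1 0 → v = a * Y 0 1 + b * Y 1 1 →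
      t₀ * a ^ 2 + t₁ * b ^ 2 = q * (t₀ * u ^ 2 + t₁ * v ^ 2) := by
    intro a b u v hu hv
    have ha : a = u * Y 1 1 - v * Y 1 0 := by rw [hu, hv]; linear_combination -a * hdet
    have hb : b = -u * Y 0 1 + v * Y 0 0 := by rw [hu, hv]; linear_combination -b * hdet
    rw [ha, hb]
    linear_combination u ^ 2 * y3 + v ^ 2 * y1 - 2 * u * v * y2
  have r0 := row _ _ _ _ e00 e01
  have r1 := row _ _ _ _ e10 e11
  have col : ∀ a b : ℝ, s₀ * (X 0 0 * a + X 0 1 * b) ^ 2 + s₁ * (X 1 0 * a + X 1 1 * b) ^ 2 =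
      r * (s₀ * a ^ 2 + s₁ * b ^ 2) := by
    intro a b
    linear_combination a ^ 2 * x1 + b ^ 2 * x3 + 2 * a * b * x2
  have c0 := col (n 0 0) (n 1 0)
  have c1 := col (n 0 1) (n 1 1)
  set F := s₀ * t₀ * n 0 0 ^ 2 + s₀ * t₁ * n 0 1 ^ 2 + s₁ * t₀ * n 1 0 ^ 2 + s₁ * t₁ * n 1 1 ^ 2
    with hF
  have total : s₀ * t₀ * N 0 0 ^ 2 + s₀ * t₁ * N 0 1 ^ 2 + s₁ * t₀ * N 1 0 ^ 2 +
      s₁ * t₁ * N 1 1 ^ 2 = q * r * F := by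
    rw [hF]
    linear_combination s₀ * r0 + s₁ * r1 + q * t₀ * c0 + q * t₁ * c1
  have hF0 : 0 ≤ F := by positivity
  have hle : q * r * F ≤ F := mul_le_of_le_one_left hF0 (mul_le_one₀ hq1 hr0 hr1)
  have hlt : F < q * r * F := by
    rw [← total, hF]
    have p00 := mul_nonneg hs0 ht0
    have p01 := mul_nonneg hs0 ht1
    have p10 := mul_nonneg hs1 ht0
    have p11 := mul_nonneg hs1 ht1
    have hpos : 0 < s₀ * t₀ + s₀ * t₁ + s₁ * t₀ + s₁ * t₁ := by linarith [mul_pos hs ht]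
    have d00 := sub_pos.mpr (hN 0 0)
    have d01 := sub_pos.mpr (hN 0 1)
    have d10 := sub_pos.mpr (hN 1 0)
    have d11 := sub_pos.mpr (hN 1 1)
    have q00 := mul_nonneg p00 d00.le
    have q01 := mul_nonneg p01 d01.le
    have q10 := mul_nonneg p10 d10.le
    have q11 := mul_nonneg p11 d11.le
    by_contra! hcon
    have z00 : s₀ * t₀ * (N 0 0 ^ 2 - n 0 0 ^ 2) = 0 := by linarith
    have z01 : s₀ * t₁ * (N 0 1 ^ 2 - n 0 1 ^ 2) = 0 := by linarith
    have z10 : s₁ * t₀ * (N 1 0 ^ 2 - n 1 0 ^ 2) = 0 := by linarith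
    have z11 : s₁ * t₁ * (N 1 1 ^ 2 - n 1 1 ^ 2) = 0 := by linarith
    have y00 := (mul_eq_zero.mp z00).resolve_right d00.ne'
    have y01 := (mul_eq_zero.mp z01).resolve_right d01.ne'
    have y10 := (mul_eq_zero.mp z10).resolve_right d10.ne'
    have y11 := (mul_eq_zero.mp z11).resolve_right d11.ne'
    linarith
  linarith

/-- If a nonzero coordinate of `w` is no larger than that of `u`, rescaling `w` makes these
coordinates equal and a shear along the other one finishes. The remaining case has a zero coordinate
in `w` and the other larger than in `u`; there an elliptic element with fixed point on the axis
works with `ν = 1`. -/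
theorem exists_isCrooked_mulVec {u₀ u₁ w₀ w₁ : ℝ} (hu0 : u₀ ≠ 0) (hu1 : u₁ ≠ 0)
    (hw : w₀ ≠ 0 ∨ w₁ ≠ 0) (h : w₀ ^ 2 ≤ u₀ ^ 2 ∨ w₁ ^ 2 ≤ u₁ ^ 2) :
    ∃ (X : SL(2, ℝ)) (ν : ℝ), IsCrooked X ∧ 1 ≤ ν ^ 2 ∧
      X 0 0 * u₀ + X 0 1 * u₁ = ν * w₀ ∧ X 1 0 * u₀ + X 1 1 * u₁ = ν * w₁ := by
  have shear0 : ∀ (_ : w₀ ≠ 0) (_ : w₀ ^ 2 ≤ u₀ ^ 2), ∃ (X : SL(2, ℝ)) (ν : ℝ), IsCrooked X ∧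
      1 ≤ ν ^ 2 ∧ X 0 0 * u₀ + X 0 1 * u₁ = ν * w₀ ∧ X 1 0 * u₀ + X 1 1 * u₁ = ν * w₁ := by
    intro h0 hle
    refine ⟨SL2.of 1 0 ((u₀ / w₀ * w₁ - u₁) / u₀) 1 (by ring), u₀ / w₀,
      Or.inl ⟨rfl, by simp⟩, ?_, ?_, ?_⟩
    · rw [div_pow, one_le_div (by positivity)]; exact hle
    · simp; field_simp
    · simp; field_simp; ring
  have shear1 : ∀ (_ : w₁ ≠ 0) (_ : w₁ ^ 2 ≤ u₁ ^ 2), ∃ (X : SL(2, ℝ)) (ν : ℝ), IsCrooked X ∧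
      1 ≤ ν ^ 2 ∧ X 0 0 * u₀ + X 0 1 * u₁ = ν * w₀ ∧ X 1 0 * u₀ + X 1 1 * u₁ = ν * w₁ := by
    intro h0 hle
    refine ⟨SL2.of 1 ((u₁ / w₁ * w₀ - u₀) / u₁) 0 1 (by ring), u₁ / w₁,
      Or.inl ⟨rfl, by simp⟩, ?_, ?_, ?_⟩
    · rw [div_pow, one_le_div (by positivity)]; exact hle
    · simp; field_simp; ring
    · simp; field_simp
  by_cases h0 : w₀ = 0
  · have h1 : w₁ ≠ 0 := hw.resolve_left (not_not.mpr h0)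
    rcases le_or_gt (w₁ ^ 2) (u₁ ^ 2) with hle | hlt
    · exact shear1 h1 hle
    -- Equal diagonal entries `u₁ / w₁` and the image `(0, w₁)` determine this matrix; its
    -- off-diagonal product is `(u₁ / w₁)² - 1 < 0`.
    · refine ⟨SL2.of (u₁ / w₁) (-(u₀ / w₁)) ((w₁ ^ 2 - u₁ ^ 2) / (w₁ * u₀)) (u₁ / w₁)
        (by field_simp; ring), 1, Or.inl ⟨rfl, ?_⟩, by norm_num, ?_, ?_⟩
      · have : -(u₀ / w₁) * ((w₁ ^ 2 - u₁ ^ 2) / (w₁ * u₀)) = -((w₁ ^ 2 - u₁ ^ 2) / w₁ ^ 2) := by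
          field_simp
        simp only [SL2.of_01, SL2.of_10]
        rw [this, neg_nonpos]
        exact div_nonneg (by linarith) (sq_nonneg _)
      · rw [h0]; simp; field_simp; ring
      · simp; field_simp; ring
  · by_cases h1 : w₁ = 0
    · rcases le_or_gt (w₀ ^ 2) (u₀ ^ 2) with hle | hlt
      · exact shear0 h0 hle
      · refine ⟨SL2.of (u₀ / w₀) ((w₀ ^ 2 - u₀ ^ 2) / (w₀ * u₁)) (-(u₁ / w₀)) (u₀ / w₀)
          (by field_simp; ring), 1, Or.inl ⟨rfl, ?_⟩, by norm_num, ?_, ?_⟩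
        · have : ((w₀ ^ 2 - u₀ ^ 2) / (w₀ * u₁)) * -(u₁ / w₀) = -((w₀ ^ 2 - u₀ ^ 2) / w₀ ^ 2) := by
            field_simp
          simp only [SL2.of_01, SL2.of_10]
          rw [this, neg_nonpos]
          exact div_nonneg (by linarith) (sq_nonneg _)
        · simp; field_simp; ring
        · rw [h1]; simp; field_simp; ring
    · exact h.elim (shear0 h0) (shear1 h1)

theorem exists_isCrooked_of_not_entriesExceed {N n : SL(2, ℝ)} (hn : ∀ i j, n i j ≠ 0)
    (h : ¬ EntriesExceed N n) : ∃ X Y : SL(2, ℝ), IsCrooked X ∧ IsCrooked Y ∧ X * n = N * Y := by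
  rw [EntriesExceed] at h
  push Not at h
  obtain ⟨i, j, hij⟩ := h
  have hdet := SL2.det_eq N
  obtain ⟨X, ν, hX, hν, e0, e1⟩ := exists_isCrooked_mulVec (hn 0 j) (hn 1 j)
    (w₀ := N 0 j) (w₁ := N 1 j) (by
      by_contra! hcon
      fin_cases j <;> simp at hcon <;> simp [hcon] at hdet)
    (by fin_cases i; exacts [Or.inl hij, Or.inr hij])
  -- This matrix has the basis vector `eⱼ` as eigenvector for `ν`, hence is triangular with `1 ≤ ν²`
  -- on the diagonal.
  refine ⟨X, N⁻¹ * (X * n), hX, Or.inr ?_, by group⟩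
  obtain ⟨i1, i2, i3, i4⟩ := SL2.inv_apply N
  simp only [SL2.mul_apply, i1, i2, i3, i4]
  fin_cases j
  · left
    simp only [Fin.zero_eta] at e0 e1
    rw [e0, e1]
    refine ⟨by ring, ?_⟩
    have : N 1 1 * (ν * N 0 0) + -N 0 1 * (ν * N 1 0) = ν := by linear_combination ν * hdet
    rwa [this]
  · right
    simp only [Fin.mk_one] at e0 e1
    rw [e0, e1]
    refine ⟨by ring, ?_⟩
    have : -N 1 0 * (ν * N 0 1) + N 0 0 * (ν * N 1 1) = ν := by linear_combination ν * hdet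
    rwa [this]

theorem disjoint_crookedPlane_iff {G G' N n : SL(2, ℝ)} (hn : G⁻¹ * G' = n)
    (hn0 : ∀ i j, n i j ≠ 0) :
    Disjoint (crookedPlane (π G • imagAxis))
      (π (G * N * G'⁻¹) • crookedPlane (π G' • imagAxis)) ↔ EntriesExceed N n := by
  have hG : G' = G * n := by rw [← hn]; group
  constructor
  · intro h
    by_contra hN
    obtain ⟨X, Y, hX, hY, hXY⟩ := exists_isCrooked_of_not_entriesExceed hn0 hN
    refine Set.disjoint_left.mp h (mk_conj_mem_crookedPlane_iff.mpr hX)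
      ⟨π (G' * Y * G'⁻¹), mk_conj_mem_crookedPlane_iff.mpr hY, ?_⟩
    change π (G * N * G'⁻¹ * (G' * Y * G'⁻¹)) = π (G * X * G⁻¹)
    congr 1
    have : X = N * Y * n⁻¹ := by rw [← hXY]; group
    rw [this, hG]; group
  · intro hN
    rw [Set.disjoint_left]
    rintro h hh ⟨y, hy, hxy⟩
    obtain ⟨X, rfl⟩ := PSL.exists_conj G h
    obtain ⟨Y, rfl⟩ := PSL.exists_conj G' y
    rw [mk_conj_mem_crookedPlane_iff] at hh hy
    change π (G * N * G'⁻¹ * (G' * Y * G'⁻¹)) = π (G * X * G⁻¹) at hxy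
    rcases PSL.mk_eq_mk_iff.mp hxy with e | e
    · refine not_entriesExceed_of_isCrooked hh hy ?_ hN
      have : X = G⁻¹ * (G * X * G⁻¹) * G := by group
      rw [this, ← e, hG]; group
    · refine not_entriesExceed_of_isCrooked hh.neg hy ?_ hN
      have : -X = G⁻¹ * -(G * X * G⁻¹) * G := by
        rw [mul_neg, neg_mul]; congr 1; group
      rw [this, ← e, hG]; group

/-! ### The away component as entrywise domination -/

/-- The sign pattern of the transition matrix between two lines oriented away from each other. -/
def IsAway (n : SL(2, ℝ)) : Prop := n 0 0 < 0 ∧ n 0 1 < 0 ∧ 0 < n 1 0 ∧ 0 < n 1 1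

/-- Entrywise domination of matrices with the sign pattern of `IsAway`. -/
def Dominates (N n : SL(2, ℝ)) : Prop :=
  N 0 0 < n 0 0 ∧ N 0 1 < n 0 1 ∧ n 1 0 < N 1 0 ∧ n 1 1 < N 1 1

theorem OrientedGeodesic.IsImage.neg {L : OrientedGeodesic} {G : SL(2, ℝ)} (h : L.IsImage G) :
    L.IsImage (-G) := by
  rw [OrientedGeodesic.IsImage, PSL.mk_neg]; exact h

theorem EntriesExceed.neg {N n : SL(2, ℝ)} (h : EntriesExceed N n) : EntriesExceed (-N) n := by
  intro i j
  simpa using h i j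

theorem IsAway.ne_zero {n : SL(2, ℝ)} (h : IsAway n) : ∀ i j, n i j ≠ 0 := by
  obtain ⟨h1, h2, h3, h4⟩ := h
  intro i j
  fin_cases i <;> fin_cases j
  exacts [h1.ne, h2.ne, h3.ne', h4.ne']

theorem isAway_or_isAway_neg {n : SL(2, ℝ)} (h1 : n 0 0 * n 1 0 < 0) (h2 : n 0 1 * n 1 1 < 0)
    (h3 : 0 < n 1 0 * n 1 1) : IsAway n ∨ IsAway (-n) := by
  simp only [IsAway, SL2.neg_apply, neg_lt_zero, Left.neg_pos_iff]
  rcases pos_and_pos_or_neg_and_neg_of_mul_pos h3 with ⟨h4, h5⟩ | ⟨h4, h5⟩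
  · exact Or.inl ⟨neg_of_mul_neg_left h1 h4.le, neg_of_mul_neg_left h2 h5.le, h4, h5⟩
  · exact Or.inr ⟨pos_of_mul_neg_left h1 h4.le, pos_of_mul_neg_left h2 h5.le, h4, h5⟩

theorem Dominates.isAway {N n : SL(2, ℝ)} (hn : IsAway n) (h : Dominates N n) : IsAway N :=
  ⟨h.1.trans hn.1, h.2.1.trans hn.2.1, hn.2.2.1.trans h.2.2.1, hn.2.2.2.trans h.2.2.2⟩

theorem dominates_iff {N n : SL(2, ℝ)} (hn : IsAway n) (hN : IsAway N) :
    Dominates N n ↔ EntriesExceed N n := by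
  obtain ⟨h1, h2, h3, h4⟩ := hn
  obtain ⟨k1, k2, k3, k4⟩ := hN
  constructor
  · rintro ⟨d1, d2, d3, d4⟩ i j
    fin_cases i <;> fin_cases j <;> simp only [Fin.zero_eta, Fin.mk_one] <;> nlinarith
  · intro h
    have e00 := h 0 0
    have e01 := h 0 1
    have e10 := h 1 0
    have e11 := h 1 1
    refine ⟨?_, ?_, ?_, ?_⟩ <;> by_contra! hle <;> nlinarith

theorem mk_mem_awayComponent_iff {L L' : OrientedGeodesic} {G G' N n : SL(2, ℝ)}
    (hL : L.IsImage G) (hL' : L'.IsImage G') (hn : G⁻¹ * G' = n) (hn0 : ∀ i j, n i j ≠ 0) :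
    π (G * N * G'⁻¹) ∈ awayComponent L L' ↔ EntriesExceed N n ∧
      N 0 0 * N 1 0 < 0 ∧ N 0 1 * N 1 1 < 0 ∧ 0 < N 0 0 * N 0 1 ∧ 0 < N 1 0 * N 1 1 := by
  rw [awayComponent, Set.mem_ofPred_eq, hL.1, hL'.1, mk_mem_lengtheningSet_iff hn hn0]
  refine and_congr_right fun hN => ?_
  have hN0 : ∀ i j, N i j ≠ 0 := by
    intro i j h0
    have := hN i j
    rw [h0] at this
    nlinarith [sq_nonneg (n i j)]
  refine awayFromEachOther_iff hL (G' := G * N) ⟨?_, ?_⟩ (by group) hN0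
  · rw [OrientedGeodesic.smul_line, hL'.1, ← mul_smul]
    change π (G * N * G'⁻¹ * G') • imagAxis = _
    rw [inv_mul_cancel_right]
  · rw [OrientedGeodesic.smul_pos, hL'.2, ← mul_smul]
    change π (G * N * G'⁻¹ * G') • rightHalf = _
    rw [inv_mul_cancel_right]

/-- Frames `G`, `G'` of two oriented geodesics, with transition matrix `n` of the sign pattern
of lines oriented away from each other. -/
structure IsAwayFrame (L L' : OrientedGeodesic) (G G' n : SL(2, ℝ)) : Prop where
  left : L.IsImage G
  right : L'.IsImage G'
  eq : G⁻¹ * G' = n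
  isAway : IsAway n

theorem exists_isAwayFrame {L L' : OrientedGeodesic}
    (hdisj : Disjoint (idealClosure L.line) (idealClosure L'.line))
    (haway : AwayFromEachOther L L') : ∃ G G' n, IsAwayFrame L L' G G' n := by
  obtain ⟨G, hL⟩ := L.exists_isImage
  obtain ⟨G', hL'⟩ := L'.exists_isImage
  rw [hL.1, hL'.1] at hdisj
  have hn0 := entries_ne_zero_of_disjoint rfl hdisj
  obtain ⟨h1, h2, -, h3⟩ := (awayFromEachOther_iff hL hL' rfl hn0).mp haway
  rcases isAway_or_isAway_neg h1 h2 h3 with h | h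
  · exact ⟨G, G', _, hL, hL', rfl, h⟩
  · exact ⟨G, -G', _, hL, hL'.neg, by rw [mul_neg], h⟩

namespace IsAwayFrame

variable {L L' : OrientedGeodesic} {G G' n : SL(2, ℝ)}

/-- Inverting `n` exchanges its diagonal entries and negates the others, producing the opposite sign
pattern; the sign in `-G` restores it. -/
theorem symm (hf : IsAwayFrame L L' G G' n) : IsAwayFrame L' L G' (-G) (-n⁻¹) where
  left := hf.right
  right := hf.left.neg
  eq := by rw [← hf.eq, mul_neg]; congr 1; group
  isAway := by
    obtain ⟨i1, i2, i3, i4⟩ := SL2.inv_apply n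
    obtain ⟨h1, h2, h3, h4⟩ := hf.isAway
    simp only [IsAway, SL2.neg_apply, i1, i2, i3, i4]
    exact ⟨by linarith, by linarith, by linarith, by linarith⟩

theorem mem_awayComponent_iff (hf : IsAwayFrame L L' G G' n) {h : PSL(2, ℝ)} :
    h ∈ awayComponent L L' ↔ ∃ N, Dominates N n ∧ h = π (G * N * G'⁻¹) := by
  constructor
  · intro hh
    obtain ⟨A, rfl⟩ := QuotientGroup.mk_surjective h
    obtain ⟨N, rfl⟩ : ∃ N, A = G * N * G'⁻¹ := ⟨G⁻¹ * A * G', by group⟩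
    obtain ⟨hN, h1, h2, -, h3⟩ :=
      (mk_mem_awayComponent_iff hf.left hf.right hf.eq hf.isAway.ne_zero).mp hh
    rcases isAway_or_isAway_neg h1 h2 h3 with h | h
    · exact ⟨N, (dominates_iff hf.isAway h).mpr hN, rfl⟩
    · refine ⟨-N, (dominates_iff hf.isAway h).mpr hN.neg, ?_⟩
      rw [mul_neg, neg_mul, PSL.mk_neg]
  · rintro ⟨N, hN, rfl⟩
    have h := hN.isAway hf.isAway
    rw [mk_mem_awayComponent_iff hf.left hf.right hf.eq hf.isAway.ne_zero]
    exact ⟨(dominates_iff hf.isAway h).mp hN, mul_neg_of_neg_of_pos h.1 h.2.2.1,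
      mul_neg_of_neg_of_pos h.2.1 h.2.2.2, mul_pos_of_neg_of_neg h.1 h.2.1,
      mul_pos h.2.2.1 h.2.2.2⟩

theorem inv_mem_awayComponent (hf : IsAwayFrame L L' G G' n) {h : PSL(2, ℝ)}
    (hh : h ∈ awayComponent L L') : h⁻¹ ∈ awayComponent L' L := by
  obtain ⟨N, hN, rfl⟩ := hf.mem_awayComponent_iff.mp hh
  refine hf.symm.mem_awayComponent_iff.mpr ⟨-N⁻¹, ?_, ?_⟩
  · obtain ⟨i1, i2, i3, i4⟩ := SL2.inv_apply n
    obtain ⟨j1, j2, j3, j4⟩ := SL2.inv_apply N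
    obtain ⟨h1, h2, h3, h4⟩ := hN
    simp only [Dominates, SL2.neg_apply, i1, i2, i3, i4, j1, j2, j3, j4]
    exact ⟨by linarith, by linarith, by linarith, by linarith⟩
  · change π (G * N * G'⁻¹)⁻¹ = _
    congr 1
    rw [show (-G)⁻¹ = -G⁻¹ from inv_neg]
    simp [mul_assoc]

end IsAwayFrame

/-! ### The factorization into stem and shear -/

theorem mem_stemQuadrant_iff_exists {L : OrientedGeodesic} {G : SL(2, ℝ)} (hL : L.IsImage G)
    {h : PSL(2, ℝ)} : h ∈ stemQuadrant L ↔
      ∃ X : SL(2, ℝ), X 0 0 = X 1 1 ∧ 0 < X 0 0 ∧ 0 < X 0 1 ∧ 0 < X 1 0 ∧ h = π (G * X * G⁻¹) := by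
  constructor
  · intro hh
    obtain ⟨X, rfl⟩ := PSL.exists_conj G h
    obtain ⟨h1, h2, h3⟩ := (mk_conj_mem_stemQuadrant_iff hL).mp hh
    rcases lt_or_gt_of_ne (left_ne_zero_of_mul h2.ne') with h0 | h0
    · refine ⟨-X, by simpa using h1, by simpa using h0, ?_, ?_, ?_⟩
      · simpa using neg_of_mul_pos_right h2 h0.le
      · simpa using neg_of_mul_pos_right h3 h0.le
      · rw [mul_neg, neg_mul, PSL.mk_neg]
    · exact ⟨X, h1, h0, pos_of_mul_pos_right h2 h0.le, pos_of_mul_pos_right h3 h0.le, rfl⟩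
  · rintro ⟨X, h1, h2, h3, h4, rfl⟩
    exact (mk_conj_mem_stemQuadrant_iff hL).mpr ⟨h1, mul_pos h2 h3, mul_pos h2 h4⟩

/-- The product of an upper and a lower unipotent matrix. -/
def SL2.shear (y z : ℝ) : SL(2, ℝ) := SL2.of (1 + y * z) y z 1 (by ring)

theorem SL2.continuous_shear : Continuous fun p : ℝ × ℝ => SL2.shear p.1 p.2 := by
  apply SL2.continuous_of <;> fun_prop

theorem mem_stemQuadrantBoundary_iff_exists {L : OrientedGeodesic} {G : SL(2, ℝ)}
    (hL : L.IsImage G) {h : PSL(2, ℝ)} : h ∈ stemQuadrantBoundary L ↔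
      ∃ y z : ℝ, 0 ≤ y ∧ 0 ≤ z ∧ y * z = 0 ∧ h = π (G * SL2.shear y z * G⁻¹) := by
  constructor
  · intro hh
    obtain ⟨X, rfl⟩ := PSL.exists_conj G h
    obtain ⟨h1, h2, h3, h4⟩ := (mk_conj_mem_stemQuadrantBoundary_iff hL).mp hh
    have hdet := SL2.det_eq X
    rw [h4, ← h1] at hdet
    rcases mul_self_eq_one_iff.mp (by linarith : X 0 0 * X 0 0 = 1) with h0 | h0
    · rw [h0] at h1 h2 h3
      refine ⟨X 0 1, X 1 0, by linarith, by linarith, h4, ?_⟩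
      congr 3
      simp [SL2.ext_iff, SL2.shear, h0, ← h1, h4]
    · rw [h0] at h1 h2 h3
      refine ⟨-X 0 1, -X 1 0, by linarith, by linarith, by linarith, ?_⟩
      rw [← PSL.mk_neg, ← neg_mul, ← mul_neg]
      congr 3
      simp [SL2.ext_iff, SL2.shear, h0, ← h1, h4]
  · rintro ⟨y, z, hy, hz, hyz, rfl⟩
    refine (mk_conj_mem_stemQuadrantBoundary_iff hL).mpr ⟨?_, ?_, ?_, ?_⟩ <;>
      simp [SL2.shear, hyz, hy, hz]

/-- The difference of the diagonal entries of `n * P⁻¹`, as a function of `P`. -/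
def skewδ (n : SL(2, ℝ)) (P : Fin 2 → Fin 2 → ℝ) : ℝ :=
  P 0 0 * n 1 1 + P 1 0 * n 0 1 - P 0 1 * n 1 0 - P 1 1 * n 0 0

/-- The rate at which an upper shear changes `skewδ`. -/
def upperRate (n : SL(2, ℝ)) (P : Fin 2 → Fin 2 → ℝ) : ℝ := -(P 0 0 * n 1 0 + P 1 0 * n 0 0)

/-- The rate at which a lower shear changes `skewδ`. -/
def lowerRate (n : SL(2, ℝ)) (P : Fin 2 → Fin 2 → ℝ) : ℝ := -(P 0 1 * n 1 1 + P 1 1 * n 0 1)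

/-- The parameter of the upper shear in the decomposition of `P`. -/
def upperShear (n : SL(2, ℝ)) (P : Fin 2 → Fin 2 → ℝ) : ℝ := max (skewδ n P / upperRate n P) 0

/-- The parameter of the lower shear in the decomposition of `P`. -/
def lowerShear (n : SL(2, ℝ)) (P : Fin 2 → Fin 2 → ℝ) : ℝ := max (-skewδ n P / lowerRate n P) 0

theorem upperRate_pos {n N : SL(2, ℝ)} (hn : IsAway n) (hN : IsAway N) :
    0 < upperRate n fun i j => N i j := by
  rw [upperRate]
  linarith [mul_neg_of_neg_of_pos hN.1 hn.2.2.1, mul_neg_of_pos_of_neg hN.2.2.1 hn.1]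

theorem lowerRate_pos {n N : SL(2, ℝ)} (hn : IsAway n) (hN : IsAway N) :
    0 < lowerRate n fun i j => N i j := by
  rw [lowerRate]
  linarith [mul_neg_of_neg_of_pos hN.2.1 hn.2.2.2, mul_neg_of_pos_of_neg hN.2.2.2 hn.2.1]

/-- Since `y z = 0`, the pair is the rescaled positive and negative part of the single number `ρ y -
σ z`. -/
theorem shear_params_unique {δ ρ σ y z : ℝ} (hρ : 0 < ρ) (hσ : 0 < σ) (hy : 0 ≤ y) (hz : 0 ≤ z)
    (hyz : y * z = 0) (h : δ = ρ * y - σ * z) : max (δ / ρ) 0 = y ∧ max (-δ / σ) 0 = z := by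
  subst h
  rcases mul_eq_zero.mp hyz with rfl | rfl
  · refine ⟨max_eq_right (div_nonpos_of_nonpos_of_nonneg ?_ hρ.le), ?_⟩
    · nlinarith [mul_nonneg hσ.le hz]
    · rw [show -(ρ * 0 - σ * z) / σ = z by field_simp; ring, max_eq_left hz]
  · refine ⟨?_, max_eq_right (div_nonpos_of_nonpos_of_nonneg ?_ hσ.le)⟩
    · rw [show (ρ * y - σ * 0) / ρ = y by field_simp; ring, max_eq_left hy]
    · nlinarith [mul_nonneg hρ.le hy]

/-- The determinant gives `1 ≤ X00`, so by the sign pattern `X⁻¹` strictly enlarges every entry of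
`n`. The shear adds nonnegative multiples of columns to each other, and within each row both entries
have the same sign. -/
theorem dominates_inv_mul_mul_shear {n X : SL(2, ℝ)} (hn : IsAway n) (had : X 0 0 = X 1 1)
    (ha : 0 < X 0 0) (hb : 0 < X 0 1) (hc : 0 < X 1 0) {y z : ℝ} (hy : 0 ≤ y) (hz : 0 ≤ z) :
    Dominates (X⁻¹ * n * SL2.shear y z) n := by
  obtain ⟨i1, i2, i3, i4⟩ := SL2.inv_apply X
  obtain ⟨h1, h2, h3, h4⟩ := hn
  have hdet := SL2.det_eq X
  rw [← had] at i1 hdet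
  have ha1 : 1 ≤ X 0 0 := by
    by_contra! hlt
    nlinarith [mul_pos hb hc]
  simp only [Dominates, SL2.mul_apply, i1, i2, i3, i4, SL2.shear, SL2.of_00, SL2.of_01, SL2.of_10,
    SL2.of_11]
  have m00 : X 0 0 * n 0 0 + -X 0 1 * n 1 0 < n 0 0 := by nlinarith [mul_pos hb h3]
  have m01 : X 0 0 * n 0 1 + -X 0 1 * n 1 1 < n 0 1 := by nlinarith [mul_pos hb h4]
  have m10 : n 1 0 < -X 1 0 * n 0 0 + X 0 0 * n 1 0 := by nlinarith [mul_pos_of_neg_of_neg (neg_lt_zero.mpr hc) h1]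
  have m11 : n 1 1 < -X 1 0 * n 0 1 + X 0 0 * n 1 1 := by nlinarith [mul_pos_of_neg_of_neg (neg_lt_zero.mpr hc) h2]
  generalize X 0 0 * n 0 0 + -X 0 1 * n 1 0 = m at *
  generalize X 0 0 * n 0 1 + -X 0 1 * n 1 1 = m' at *
  generalize -X 1 0 * n 0 0 + X 0 0 * n 1 0 = p at *
  generalize -X 1 0 * n 0 1 + X 0 0 * n 1 1 = p' at *
  have hyz := mul_nonneg hy hz
  refine ⟨?_, ?_, ?_, ?_⟩
  · nlinarith [mul_nonneg hyz (neg_nonneg.mpr (m00.trans h1).le), mul_nonneg hz (neg_nonneg.mpr (m01.trans h2).le)]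
  · nlinarith [mul_nonneg hy (neg_nonneg.mpr (m00.trans h1).le)]
  · nlinarith [mul_nonneg hyz (h3.trans m10).le, mul_nonneg hz (h4.trans m11).le]
  · nlinarith [mul_nonneg hy (h3.trans m10).le]

theorem shear_params_of_eq {n X : SL(2, ℝ)} (hn : IsAway n) (had : X 0 0 = X 1 1)
    (ha : 0 < X 0 0) (hb : 0 < X 0 1) (hc : 0 < X 1 0) {y z : ℝ} (hy : 0 ≤ y) (hz : 0 ≤ z)
    (hyz : y * z = 0) :
    upperShear n (fun i j => (X⁻¹ * n * SL2.shear y z) i j) = y ∧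
      lowerShear n (fun i j => (X⁻¹ * n * SL2.shear y z) i j) = z := by
  have hN := (dominates_inv_mul_mul_shear hn had ha hb hc hy hz).isAway hn
  refine shear_params_unique (upperRate_pos hn hN) (lowerRate_pos hn hN) hy hz hyz ?_
  obtain ⟨i1, i2, i3, i4⟩ := SL2.inv_apply X
  simp only [skewδ, upperRate, lowerRate, SL2.mul_apply, i1, i2, i3, i4, SL2.shear, SL2.of_00,
    SL2.of_01, SL2.of_10, SL2.of_11, hyz, ← had]
  ring

/-- The shear is chosen to equalize the diagonal of `X`. For an upper shear, multiplying the
off-diagonal entries of `X` by the positive rate gives `N00² - n00²` and `N10² - n10²`; for a lower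
shear the second columns appear instead. Domination is thus exactly what positivity requires. -/
theorem isStem_entries_of_dominates {n N : SL(2, ℝ)} (hn : IsAway n) (h : Dominates N n) :
    let y := upperShear n (fun i j => N i j)
    let z := lowerShear n (fun i j => N i j)
    let X := n * SL2.shear y z * N⁻¹
    y * z = 0 ∧ X 0 0 = X 1 1 ∧ 0 < X 0 0 ∧ 0 < X 0 1 ∧ 0 < X 1 0 := by
  intro y z X
  have hN := h.isAway hn
  have hρ := upperRate_pos hn hN
  have hσ := lowerRate_pos hn hN
  have hE := (dominates_iff hn hN).mp h
  have hdn := SL2.det_eq n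
  have hdN := SL2.det_eq N
  obtain ⟨i1, i2, i3, i4⟩ := SL2.inv_apply N
  have x00 : X 0 0 = (n 0 0 * (1 + y * z) + n 0 1 * z) * N 1 1 - (n 0 0 * y + n 0 1) * N 1 0 := by
    simp only [X, SL2.mul_apply, i1, i3, SL2.shear, SL2.of_00, SL2.of_01, SL2.of_10, SL2.of_11]
    ring
  have x01 : X 0 1 = (n 0 0 * y + n 0 1) * N 0 0 - (n 0 0 * (1 + y * z) + n 0 1 * z) * N 0 1 := by
    simp only [X, SL2.mul_apply, i2, i4, SL2.shear, SL2.of_00, SL2.of_01, SL2.of_10, SL2.of_11]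
    ring
  have x10 : X 1 0 = (n 1 0 * (1 + y * z) + n 1 1 * z) * N 1 1 - (n 1 0 * y + n 1 1) * N 1 0 := by
    simp only [X, SL2.mul_apply, i1, i3, SL2.shear, SL2.of_00, SL2.of_01, SL2.of_10, SL2.of_11]
    ring
  have x11 : X 1 1 = (n 1 0 * y + n 1 1) * N 0 0 - (n 1 0 * (1 + y * z) + n 1 1 * z) * N 0 1 := by
    simp only [X, SL2.mul_apply, i2, i4, SL2.shear, SL2.of_00, SL2.of_01, SL2.of_10, SL2.of_11]
    ring
  obtain ⟨h1, h2, h3, h4⟩ := hn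
  obtain ⟨k1, k2, k3, k4⟩ := hN
  rcases le_total 0 (skewδ n fun i j => N i j) with hδ | hδ
  · have hz : z = 0 := max_eq_right (div_nonpos_of_nonpos_of_nonneg (by linarith) hσ.le)
    have hy : upperRate n (fun i j => N i j) * y = skewδ n fun i j => N i j := by
      have : y = _ := max_eq_left (div_nonneg hδ hρ.le)
      rw [this]; field_simp
    refine ⟨by rw [hz, mul_zero], ?_⟩
    have e01 : upperRate n (fun i j => N i j) * X 0 1 = N 0 0 ^ 2 - n 0 0 ^ 2 := by
      rw [x01, hz]
      simp only [upperRate, skewδ] at hy ⊢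
      linear_combination n 0 0 * N 0 0 * hy + N 0 0 ^ 2 * hdn - n 0 0 ^ 2 * hdN
    have e10 : upperRate n (fun i j => N i j) * X 1 0 = N 1 0 ^ 2 - n 1 0 ^ 2 := by
      rw [x10, hz]
      simp only [upperRate, skewδ] at hy ⊢
      linear_combination -n 1 0 * N 1 0 * hy + N 1 0 ^ 2 * hdn - n 1 0 ^ 2 * hdN
    have e00 : upperRate n (fun i j => N i j) * X 0 0 = -(n 0 0 * n 1 0) - N 0 0 * N 1 0 := by
      rw [x00, hz]
      simp only [upperRate, skewδ] at hy ⊢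
      linear_combination -n 0 0 * N 1 0 * hy - N 0 0 * N 1 0 * hdn - n 0 0 * n 1 0 * hdN
    refine ⟨?_, ?_, ?_, ?_⟩
    · rw [x00, x11, hz]
      simp only [upperRate, skewδ] at hy ⊢
      linear_combination hy
    · refine (mul_pos_iff_of_pos_left hρ).mp (e00.symm ▸ ?_)
      linarith [mul_neg_of_neg_of_pos h1 h3, mul_neg_of_neg_of_pos k1 k3]
    · exact (mul_pos_iff_of_pos_left hρ).mp (e01.symm ▸ sub_pos.mpr (hE 0 0))
    · exact (mul_pos_iff_of_pos_left hρ).mp (e10.symm ▸ sub_pos.mpr (hE 1 0))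
  · have hy : y = 0 := max_eq_right (div_nonpos_of_nonpos_of_nonneg hδ hρ.le)
    have hz : lowerRate n (fun i j => N i j) * z = -skewδ n fun i j => N i j := by
      have : z = _ := max_eq_left (div_nonneg (neg_nonneg.mpr hδ) hσ.le)
      rw [this]; field_simp
    refine ⟨by rw [hy, zero_mul], ?_⟩
    have e01 : lowerRate n (fun i j => N i j) * X 0 1 = N 0 1 ^ 2 - n 0 1 ^ 2 := by
      rw [x01, hy]
      simp only [lowerRate, skewδ] at hz ⊢
      linear_combination -n 0 1 * N 0 1 * hz + N 0 1 ^ 2 * hdn - n 0 1 ^ 2 * hdN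
    have e10 : lowerRate n (fun i j => N i j) * X 1 0 = N 1 1 ^ 2 - n 1 1 ^ 2 := by
      rw [x10, hy]
      simp only [lowerRate, skewδ] at hz ⊢
      linear_combination n 1 1 * N 1 1 * hz + N 1 1 ^ 2 * hdn - n 1 1 ^ 2 * hdN
    have e00 : lowerRate n (fun i j => N i j) * X 0 0 = -(n 0 1 * n 1 1) - N 0 1 * N 1 1 := by
      rw [x00, hy]
      simp only [lowerRate, skewδ] at hz ⊢
      linear_combination n 0 1 * N 1 1 * hz - N 0 1 * N 1 1 * hdn - n 0 1 * n 1 1 * hdN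
    refine ⟨?_, ?_, ?_, ?_⟩
    · rw [x00, x11, hy]
      simp only [lowerRate, skewδ] at hz ⊢
      linear_combination -hz
    · refine (mul_pos_iff_of_pos_left hσ).mp (e00.symm ▸ ?_)
      linarith [mul_neg_of_neg_of_pos h2 h4, mul_neg_of_neg_of_pos k2 k4]
    · exact (mul_pos_iff_of_pos_left hσ).mp (e01.symm ▸ sub_pos.mpr (hE 0 1))
    · exact (mul_pos_iff_of_pos_left hσ).mp (e10.symm ▸ sub_pos.mpr (hE 1 1))

/-- Homogeneity of degree 0 lets the parameters be computed from the products `Nᵢⱼ N10`, which are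
well defined and continuous on PSL(2, ℝ), unlike the entries themselves. -/
theorem upperShear_mul_right (n : SL(2, ℝ)) (P : Fin 2 → Fin 2 → ℝ) {r : ℝ} (hr : r ≠ 0) :
    upperShear n (fun i j => P i j * r) = upperShear n P := by
  have h1 : skewδ n (fun i j => P i j * r) = skewδ n P * r := by simp only [skewδ]; ring
  have h2 : upperRate n (fun i j => P i j * r) = upperRate n P * r := by
    simp only [upperRate]; ring
  rw [upperShear, upperShear, h1, h2, mul_div_mul_right _ _ hr]

theorem lowerShear_mul_right (n : SL(2, ℝ)) (P : Fin 2 → Fin 2 → ℝ) {r : ℝ} (hr : r ≠ 0) :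
    lowerShear n (fun i j => P i j * r) = lowerShear n P := by
  have h1 : skewδ n (fun i j => P i j * r) = skewδ n P * r := by simp only [skewδ]; ring
  have h2 : lowerRate n (fun i j => P i j * r) = lowerRate n P * r := by
    simp only [lowerRate]; ring
  rw [lowerShear, lowerShear, h1, h2, ← neg_mul, mul_div_mul_right _ _ hr]

/-! ### The product homeomorphism and the connected component -/

/-- The entries of a lift of `h` in the frames `G`, `G'`, multiplied by its lower left entry. -/
def PSL.frameEntries (G G' : SL(2, ℝ)) (h : PSL(2, ℝ)) : Fin 2 → Fin 2 → ℝ :=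
  fun i j => PSL.frameMul G G' i j 1 0 h

/-- The factor of `h` in the boundary of the stem quadrant. -/
def PSL.boundaryFactor (G G' n : SL(2, ℝ)) (h : PSL(2, ℝ)) : PSL(2, ℝ) :=
  π (G' * SL2.shear (upperShear n (PSL.frameEntries G G' h))
    (lowerShear n (PSL.frameEntries G G' h)) * G'⁻¹)

theorem PSL.boundaryFactor_mk (G G' n : SL(2, ℝ)) {N : SL(2, ℝ)} (hN : N 1 0 ≠ 0) :
    PSL.boundaryFactor G G' n (π (G * N * G'⁻¹)) =
      π (G' * SL2.shear (upperShear n fun i j => N i j) (lowerShear n fun i j => N i j) * G'⁻¹) := by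
  have : PSL.frameEntries G G' (π (G * N * G'⁻¹)) = fun i j => N i j * N 1 0 := by
    ext i j
    exact PSL.frameMul_mk G G' N i j 1 0
  rw [PSL.boundaryFactor, this, upperShear_mul_right n (fun i j => N i j) hN,
    lowerShear_mul_right n (fun i j => N i j) hN]

namespace IsAwayFrame

variable {L L' : OrientedGeodesic} {G G' n : SL(2, ℝ)}

theorem rates_ne_zero (hf : IsAwayFrame L L' G G' n) {h : PSL(2, ℝ)}
    (hh : h ∈ awayComponent L L') : upperRate n (PSL.frameEntries G G' h) ≠ 0 ∧
      lowerRate n (PSL.frameEntries G G' h) ≠ 0 := by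
  obtain ⟨N, hN, rfl⟩ := hf.mem_awayComponent_iff.mp hh
  have hA := hN.isAway hf.isAway
  have h1 : upperRate n (PSL.frameEntries G G' (π (G * N * G'⁻¹))) =
      upperRate n (fun i j => N i j) * N 1 0 := by
    simp only [upperRate, PSL.frameEntries, PSL.frameMul_mk]; ring
  have h2 : lowerRate n (PSL.frameEntries G G' (π (G * N * G'⁻¹))) =
      lowerRate n (fun i j => N i j) * N 1 0 := by
    simp only [lowerRate, PSL.frameEntries, PSL.frameMul_mk]; ring
  rw [h1, h2]
  exact ⟨mul_ne_zero (upperRate_pos hf.isAway hA).ne' (hA.ne_zero 1 0),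
    mul_ne_zero (lowerRate_pos hf.isAway hA).ne' (hA.ne_zero 1 0)⟩

theorem continuous_boundaryFactor (hf : IsAwayFrame L L' G G' n) :
    Continuous fun h : awayComponent L L' => PSL.boundaryFactor G G' n h := by
  have hE : ∀ i j, Continuous fun h : awayComponent L L' => PSL.frameEntries G G' h i j :=
    fun i j => (PSL.continuous_frameMul G G' i j 1 0).comp continuous_subtype_val
  have hδ : Continuous fun h : awayComponent L L' => skewδ n (PSL.frameEntries G G' h) := by
    simp only [skewδ]; fun_prop
  have hρ : Continuous fun h : awayComponent L L' => upperRate n (PSL.frameEntries G G' h) := by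
    simp only [upperRate]; fun_prop
  have hσ : Continuous fun h : awayComponent L L' => lowerRate n (PSL.frameEntries G G' h) := by
    simp only [lowerRate]; fun_prop
  have hy : Continuous fun h : awayComponent L L' => upperShear n (PSL.frameEntries G G' h) :=
    (hδ.div hρ fun h => (hf.rates_ne_zero h.2).1).max continuous_const
  have hz : Continuous fun h : awayComponent L L' => lowerShear n (PSL.frameEntries G G' h) :=
    (hδ.neg.div hσ fun h => (hf.rates_ne_zero h.2).2).max continuous_const
  exact PSL.continuous_mk.comp ((continuous_const.mul
    (SL2.continuous_shear.comp (hy.prodMk hz))).mul continuous_const)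

theorem mul_mem_awayComponent (hf : IsAwayFrame L L' G G' n) {g g' : PSL(2, ℝ)}
    (hg : g ∈ (stemQuadrant L)⁻¹) (hg' : g' ∈ stemQuadrantBoundary L') :
    g * g' ∈ awayComponent L L' ∧ PSL.boundaryFactor G G' n (g * g') = g' := by
  obtain ⟨X, had, ha, hb, hc, hX⟩ := (mem_stemQuadrant_iff_exists hf.left).mp hg
  obtain ⟨y, z, hy, hz, hyz, rfl⟩ := (mem_stemQuadrantBoundary_iff_exists hf.right).mp hg'
  have hg2 : g = π (G * X⁻¹ * G⁻¹) := by
    rw [inv_eq_iff_eq_inv.mp hX]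
    change π (G * X * G⁻¹)⁻¹ = _
    congr 1; group
  have hdom := dominates_inv_mul_mul_shear hf.isAway had ha hb hc hy hz
  have hprod : g * π (G' * SL2.shear y z * G'⁻¹) = π (G * (X⁻¹ * n * SL2.shear y z) * G'⁻¹) := by
    rw [hg2]
    change π (G * X⁻¹ * G⁻¹ * (G' * SL2.shear y z * G'⁻¹)) = _
    congr 1
    rw [← hf.eq]; group
  obtain ⟨ey, ez⟩ := shear_params_of_eq hf.isAway had ha hb hc hy hz hyz
  rw [hprod]
  refine ⟨hf.mem_awayComponent_iff.mpr ⟨_, hdom, rfl⟩, ?_⟩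
  rw [PSL.boundaryFactor_mk G G' n ((hdom.isAway hf.isAway).ne_zero 1 0), ey, ez]

theorem boundaryFactor_mem (hf : IsAwayFrame L L' G G' n) {h : PSL(2, ℝ)}
    (hh : h ∈ awayComponent L L') :
    h * (PSL.boundaryFactor G G' n h)⁻¹ ∈ (stemQuadrant L)⁻¹ ∧
      PSL.boundaryFactor G G' n h ∈ stemQuadrantBoundary L' := by
  obtain ⟨N, hN, rfl⟩ := hf.mem_awayComponent_iff.mp hh
  rw [PSL.boundaryFactor_mk G G' n ((hN.isAway hf.isAway).ne_zero 1 0)]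
  obtain ⟨hyz, had, ha, hb, hc⟩ := isStem_entries_of_dominates hf.isAway hN
  refine ⟨(mem_stemQuadrant_iff_exists hf.left).mpr ⟨_, had, ha, hb, hc, ?_⟩,
    (mem_stemQuadrantBoundary_iff_exists hf.right).mpr
      ⟨_, _, le_max_right _ _, le_max_right _ _, hyz, rfl⟩⟩
  generalize SL2.shear (upperShear n fun i j => N i j) (lowerShear n fun i j => N i j) = Y
  change π (G * N * G'⁻¹ * (G' * Y * G'⁻¹)⁻¹)⁻¹ = _
  congr 1
  rw [← hf.eq]; group

/-- The product map from the inverse of the stem quadrant of `L` times the boundary of the stem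
quadrant of `L'`. -/
def mulHomeomorph (hf : IsAwayFrame L L' G G' n) :
    ↥((stemQuadrant L)⁻¹) × ↥(stemQuadrantBoundary L') ≃ₜ ↥(awayComponent L L') where
  toFun p := ⟨p.1 * p.2, (hf.mul_mem_awayComponent p.1.2 p.2.2).1⟩
  invFun h := (⟨_, (hf.boundaryFactor_mem h.2).1⟩, ⟨_, (hf.boundaryFactor_mem h.2).2⟩)
  left_inv p := by
    have h := (hf.mul_mem_awayComponent p.1.2 p.2.2).2
    ext
    · simp [h]
    · simp [h]
  right_inv h := by simp
  continuous_toFun := by fun_prop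
  continuous_invFun := by
    have := hf.continuous_boundaryFactor
    exact ((continuous_subtype_val.mul this.inv).subtype_mk _).prodMk (this.subtype_mk _)

theorem isPreconnected_awayComponent (hf : IsAwayFrame L L' G G' n) :
    IsPreconnected (awayComponent L L') := by
  have h1 : IsPreconnected (stemQuadrant L) := by
    -- The absolute values make `f` defined and continuous on the whole plane; on the open positive
    -- quadrant the two diagonal entries agree.
    let f : ℝ × ℝ → PSL(2, ℝ) := fun p => π (G * SL2.of (√ (1 + |p.1 * p.2|)) p.1 p.2
      ((1 + p.1 * p.2) / √ (1 + |p.1 * p.2|)) (by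
        have : √ (1 + |p.1 * p.2|) ≠ 0 := (Real.sqrt_pos.mpr (by positivity)).ne'
        field_simp; ring) * G⁻¹)
    have hcont : Continuous f := by
      refine PSL.continuous_mk.comp ((continuous_const.mul ?_).mul continuous_const)
      apply SL2.continuous_of
      · fun_prop
      · fun_prop
      · fun_prop
      · refine Continuous.div (by fun_prop) (by fun_prop) fun p => ?_
        exact (Real.sqrt_pos.mpr (by positivity)).ne'
    have himg : stemQuadrant L = f '' (Set.Ioi 0 ×ˢ Set.Ioi 0) := by
      ext h
      rw [mem_stemQuadrant_iff_exists hf.left]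
      constructor
      · rintro ⟨X, had, ha, hb, hc, rfl⟩
        refine ⟨(X 0 1, X 1 0), ⟨hb, hc⟩, ?_⟩
        have hdet := SL2.det_eq X
        have hs : √ (1 + |X 0 1 * X 1 0|) = X 0 0 := by
          rw [abs_of_pos (mul_pos hb hc), Real.sqrt_eq_iff_mul_self_eq_of_pos ha]
          rw [← had] at hdet; linarith
        simp only [f]
        congr 3
        simp only [SL2.ext_iff, SL2.of_00, SL2.of_01, SL2.of_10, SL2.of_11, true_and, hs]
        rw [div_eq_iff ha.ne']
        linarith
      · rintro ⟨⟨b, c⟩, ⟨hb, hc⟩, rfl⟩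
        have hp : 0 < b * c := mul_pos hb hc
        have hs : 0 < √ (1 + |b * c|) := Real.sqrt_pos.mpr (by positivity)
        refine ⟨_, ?_, ?_, ?_, ?_, rfl⟩
        · simp only [SL2.of_00, SL2.of_11]
          rw [eq_div_iff hs.ne', Real.mul_self_sqrt (by positivity), abs_of_pos hp]
        · exact hs
        · exact hb
        · exact hc
    rw [himg]
    exact (isPreconnected_Ioi.prod isPreconnected_Ioi).image f hcont.continuousOn
  have h2 : IsPreconnected (stemQuadrantBoundary L') := by
    -- The boundary is a line: two half-lines of unipotents, upper for `t ≥ 0` and lower for `t ≤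
    -- 0`, meeting at the identity.
    let f : ℝ → PSL(2, ℝ) := fun t => π (G' * SL2.shear (max t 0) (max (-t) 0) * G'⁻¹)
    have hcont : Continuous f :=
      PSL.continuous_mk.comp ((continuous_const.mul (SL2.continuous_shear.comp
        (f := fun t : ℝ => (max t 0, max (-t) 0)) (by fun_prop))).mul continuous_const)
    have himg : stemQuadrantBoundary L' = Set.range f := by
      ext h
      rw [mem_stemQuadrantBoundary_iff_exists hf.right]
      constructor
      · rintro ⟨y, z, hy, hz, hyz, rfl⟩
        refine ⟨y - z, ?_⟩
        rcases mul_eq_zero.mp hyz with rfl | rfl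
        · simp [f, hz]
        · simp [f, hy]
      · rintro ⟨t, rfl⟩
        refine ⟨_, _, le_max_right _ _, le_max_right _ _, ?_, rfl⟩
        rcases le_total 0 t with h | h <;> simp [h]
    rw [himg]
    exact isPreconnected_range hcont
  have h3 : awayComponent L L' = (fun p : PSL(2, ℝ) × PSL(2, ℝ) => p.1⁻¹ * p.2) ''
      (stemQuadrant L ×ˢ stemQuadrantBoundary L') := by
    ext h
    constructor
    · intro hh
      obtain ⟨m1, m2⟩ := hf.boundaryFactor_mem hh
      refine ⟨(_, PSL.boundaryFactor G G' n h), ⟨m1, m2⟩, ?_⟩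
      change (h * (PSL.boundaryFactor G G' n h)⁻¹)⁻¹⁻¹ * PSL.boundaryFactor G G' n h = h
      rw [inv_inv, inv_mul_cancel_right]
    · rintro ⟨⟨g, g'⟩, ⟨hg, hg'⟩, rfl⟩
      exact (hf.mul_mem_awayComponent (by simpa using hg) hg').1
  rw [h3]
  exact (h1.prod h2).image _ (by fun_prop)

theorem nonempty_awayComponent (hf : IsAwayFrame L L' G G' n) : (awayComponent L L').Nonempty := by
  have h1 : π (G * SL2.of (5 / 4) (3 / 4) (3 / 4) (5 / 4) (by norm_num) * G⁻¹) ∈ stemQuadrant L :=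
    (mem_stemQuadrant_iff_exists hf.left).mpr
      ⟨_, rfl, by simp, by simp, by simp, rfl⟩
  have h2 : π (G' * SL2.shear 0 0 * G'⁻¹) ∈ stemQuadrantBoundary L' :=
    (mem_stemQuadrantBoundary_iff_exists hf.right).mpr
      ⟨0, 0, le_rfl, le_rfl, mul_zero _, rfl⟩
  exact ⟨_, (hf.mul_mem_awayComponent (Set.inv_mem_inv.mpr h1) h2).1⟩

theorem exists_eq_connectedComponentIn (hf : IsAwayFrame L L' G G' n) :
    ∃ h ∈ lengtheningSet L.line L'.line,
      awayComponent L L' = connectedComponentIn (lengtheningSet L.line L'.line) h := by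
  obtain ⟨h, hh⟩ := hf.nonempty_awayComponent
  refine ⟨h, hh.1, Set.Subset.antisymm ?_ ?_⟩
  · exact hf.isPreconnected_awayComponent.subset_connectedComponentIn hh fun x hx => hx.1
  · set T := connectedComponentIn (lengtheningSet L.line L'.line) h
    have hT : IsPreconnected T := isPreconnected_connectedComponentIn
    have hhT : h ∈ T := mem_connectedComponentIn hh.1
    have hTC : T ⊆ lengtheningSet L.line L'.line := connectedComponentIn_subset _ _
    -- On the lengthening set the entries of `N` exceed others in absolute value, so their products
    -- never vanish and keep their sign on a connected subset. These signs single out the away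
    -- component.
    have hne : ∀ i j k l, ∀ x ∈ T, PSL.frameMul G G' i j k l x ≠ 0 := by
      intro i j k l x hx
      obtain ⟨A, rfl⟩ := QuotientGroup.mk_surjective x
      obtain ⟨N, rfl⟩ : ∃ N, A = G * N * G'⁻¹ := ⟨G⁻¹ * A * G', by group⟩
      have hN := hTC hx
      rw [hf.left.1, hf.right.1, mk_mem_lengtheningSet_iff hf.eq hf.isAway.ne_zero] at hN
      have hN0 : ∀ i j, N i j ≠ 0 := by
        intro i j h0
        have := hN i j
        rw [h0] at this
        nlinarith [sq_nonneg (n i j)]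
      rw [PSL.frameMul_mk]
      exact mul_ne_zero (hN0 _ _) (hN0 _ _)
    have hneg : ∀ i j k l, ∀ x ∈ T, PSL.frameMul G G' i j k l h < 0 →
        PSL.frameMul G G' i j k l x < 0 := by
      intro i j k l x hx hlt
      by_contra! hle
      obtain ⟨w, hw, hw0⟩ := hT.intermediate_value hhT hx
        (PSL.continuous_frameMul G G' i j k l).continuousOn ⟨hlt.le, hle⟩
      exact hne i j k l w hw hw0
    have hpos : ∀ i j k l, ∀ x ∈ T, 0 < PSL.frameMul G G' i j k l h →
        0 < PSL.frameMul G G' i j k l x := by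
      intro i j k l x hx hlt
      by_contra! hle
      obtain ⟨w, hw, hw0⟩ := hT.intermediate_value hx hhT
        (PSL.continuous_frameMul G G' i j k l).continuousOn ⟨hle, hlt.le⟩
      exact hne i j k l w hw hw0
    have hiff : ∀ x ∈ lengtheningSet L.line L'.line, x ∈ awayComponent L L' ↔
        PSL.frameMul G G' 0 0 1 0 x < 0 ∧ PSL.frameMul G G' 0 1 1 1 x < 0 ∧
        0 < PSL.frameMul G G' 0 0 0 1 x ∧ 0 < PSL.frameMul G G' 1 0 1 1 x := by
      intro x hx
      obtain ⟨A, rfl⟩ := QuotientGroup.mk_surjective x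
      obtain ⟨N, rfl⟩ : ∃ N, A = G * N * G'⁻¹ := ⟨G⁻¹ * A * G', by group⟩
      rw [hf.left.1, hf.right.1, mk_mem_lengtheningSet_iff hf.eq hf.isAway.ne_zero] at hx
      simp only [PSL.frameMul_mk, hx, true_and,
        mk_mem_awayComponent_iff hf.left hf.right hf.eq hf.isAway.ne_zero]
    intro x hx
    obtain ⟨h1, h2, h3, h4⟩ := (hiff h hh.1).mp hh
    exact (hiff x (hTC hx)).mpr ⟨hneg _ _ _ _ x hx h1, hneg _ _ _ _ x hx h2,
      hpos _ _ _ _ x hx h3, hpos _ _ _ _ x hx h4⟩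

theorem lengtheningSet_eq (hf : IsAwayFrame L L' G G' n) :
    lengtheningSet L.line L'.line =
      {h : PSL(2, ℝ) | Disjoint (crookedPlane L.line) (h • crookedPlane L'.line)} := by
  ext h
  obtain ⟨A, rfl⟩ := QuotientGroup.mk_surjective h
  obtain ⟨N, rfl⟩ : ∃ N, A = G * N * G'⁻¹ := ⟨G⁻¹ * A * G', by group⟩
  rw [Set.mem_ofPred_eq, hf.left.1, hf.right.1,
    mk_mem_lengtheningSet_iff hf.eq hf.isAway.ne_zero,
    disjoint_crookedPlane_iff hf.eq hf.isAway.ne_zero]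

end IsAwayFrame

end

theorem propositionB4 (L L' : OrientedGeodesic)
    (hdisj : Disjoint (idealClosure L.line) (idealClosure L'.line))
    (haway : AwayFromEachOther L L') :
    lengtheningSet L.line L'.line =
        {h : PSL(2, ℝ) | Disjoint (crookedPlane L.line) (h • crookedPlane L'.line)} ∧
    (∃ h ∈ lengtheningSet L.line L'.line,
      awayComponent L L' = connectedComponentIn (lengtheningSet L.line L'.line) h) ∧
    (∃ e : ↥((stemQuadrant L)⁻¹) × ↥(stemQuadrantBoundary L') ≃ₜ ↥(awayComponent L L'),
      ∀ p, (e p : PSL(2, ℝ)) = (p.1 : PSL(2, ℝ)) * (p.2 : PSL(2, ℝ))) ∧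
    (∃ e : ↥((stemQuadrantBoundary L)⁻¹) × ↥(stemQuadrant L') ≃ₜ ↥(awayComponent L L'),
      ∀ p, (e p : PSL(2, ℝ)) = (p.1 : PSL(2, ℝ)) * (p.2 : PSL(2, ℝ))) := by
  obtain ⟨G, G', n, hf⟩ := exists_isAwayFrame hdisj haway
  refine ⟨hf.lengtheningSet_eq, hf.exists_eq_connectedComponentIn, ⟨hf.mulHomeomorph, fun p => rfl⟩,
    ?_⟩
  -- The second map is the first one for the exchanged pair `(L', L)`, transported by inversion: `g
  -- g' = (g'⁻¹ g⁻¹)⁻¹`.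
  have hinv : ∀ h : PSL(2, ℝ), h ∈ awayComponent L' L ↔ h⁻¹ ∈ awayComponent L L' := fun h =>
    ⟨hf.symm.inv_mem_awayComponent, fun hh => by simpa using hf.inv_mem_awayComponent hh⟩
  let e₁ : ↥((stemQuadrantBoundary L)⁻¹) ≃ₜ ↥(stemQuadrantBoundary L) :=
    (Homeomorph.inv PSL(2, ℝ)).subtype fun _ => Iff.rfl
  let e₂ : ↥(stemQuadrant L') ≃ₜ ↥((stemQuadrant L')⁻¹) :=
    (Homeomorph.inv PSL(2, ℝ)).subtype fun x => by simp
  let e₃ : ↥(awayComponent L' L) ≃ₜ ↥(awayComponent L L') :=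
    (Homeomorph.inv PSL(2, ℝ)).subtype hinv
  refine ⟨((e₁.prodCongr e₂).trans (Homeomorph.prodComm _ _)).trans
    (hf.symm.mulHomeomorph.trans e₃), fun p => ?_⟩
  change ((p.2 : PSL(2, ℝ))⁻¹ * (p.1 : PSL(2, ℝ))⁻¹)⁻¹ = _
  rw [mul_inv_rev, inv_inv, inv_inv]
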